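/- Let $p$ be an odd prime and let $k\ge 1$ be an integer. Write $[a,b]=a^{-1}b^{-1}ab$ and use left-normed commutators, $[a_1,\dots,a_{n+1}]=[[a_1,\dots,a_n],a_{n+1}]$; $[y,x,\overset{m}{\ldots},x]$ has $m$ entries $x$, and $[y,x,\overset{m}{\ldots},x,y]=[[y,x,\overset{m}{\ldots},x],y]$. Let $C_p$ be the cyclic group of order $p$. Let $G_k$ be the group (a finite $p$-group) $$G_k=\Big\langle x,y \;\Big|\; x^{p^{k+1}},\ y^{p^2},\ [x^{p^k},y],\ [y^p,x];\ \ [y_0,y_i]^p,\ [y_0,y_i,x],\ [y_0,y_i,y]\ \text{ for } 1\le i\le \tfrac{p^k-1}{2}\Big\rangle,\qquad y_i=x^{-i}yx^i .$$ The Frattini series of $G_k$ is $\Phi_0(G_k)=G_k$, $\Phi_{i}(G_k)=\Phi_{i-1}(G_k)^p\,[\Phi_{i-1}(G_k),\Phi_{i-1}(G_k)]$ for $i\ge1$, where $H^p$ is the subgroup generated by the $p$th powers of elements of $H$; its length is the least $l$ with $\Phi_l(G_k)=1$. **Proposition.** The Frattini series of $G_k$ has length $k+2$ if $p>3$, and length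 $k+1$ if $p=3$. It satisfies $$G_k=\Phi_0(G_k)=\langle x,y\rangle\,\Phi_1(G_k),\qquad G_k/\Phi_1(G_k)\cong C_p\times C_p,$$ $$\Phi_1(G_k)=\langle x^p,\,y^p,\,[y,x],\,[y,x,x],\ldots,[y,x,\overset{p}{\ldots},x],\,[y,x,y]\rangle\,\Phi_2(G_k),$$ $$\Phi_1(G_k)/\Phi_2(G_k)\cong\begin{cases}C_p^{\,p+3}&\text{if }k\ge2,\\ C_p^{\,p+2}&\text{if }k=1,\end{cases}$$ and, for $2\le i\le k$, $$\Phi_i(G_k)=\big\langle x^{p^i},\ [y,x,\overset{m}{\ldots},x]\ (\nu(i)\le m\le\nu(i+1)-1),\ [y,x,\overset{m}{\ldots},x,y]\ (2\nu(i-1)+1\le m\le2\nu(i)-1,\ m\text{ odd})\big\rangle\,\Phi_{i+1}(G_k),$$ $$\Phi_i(G_k)/\Phi_{i+1}(G_k)\cong\begin{cases}C_p^{\,p^i+p^{i-1}+1}&\text{for } i\ne k,\\ C_p^{\,p^k+1-(p^{k-1}-1)/(p-1)}&\text{for } i=k,\end{cases}$$ where $\nu(j)=\min\{(p^j-1)/(p-1),\,p^k\}$,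 which equals $(p^j-1)/(p-1)$ for $1\le j\le k$ and $p^k$ for $j=k+1$; lastly, $$\Phi_{k+1}(G_k)=\big\langle [y,x,\overset{m}{\ldots},x,y]\ (2\nu(k)+1\le m\le p^k-2,\ m\text{ odd})\big\rangle\cong C_p^{\,(p^{k+1}-3p^k-p+3)/(2(p-1))}.$$ -/

import Mathlib

/-- The commutator `[a, b] = a⁻¹ b⁻¹ a b`. -/
def gcomm {G : Type*} [Group G] (a b : G) : G := a⁻¹ * b⁻¹ * a * b

/-- The left-normed commutator `[y, x, …, x]` with `m` entries `x`
(so it is `y` for `m = 0`, `[y, x]` for `m = 1` and `[[y, x], x]` for `m = 2`). -/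
def leftComm {G : Type*} [Group G] (y x : G) : ℕ → G
  | 0 => y
  | m + 1 => gcomm (leftComm y x m) x

/-- The subgroup `H ^ p`, generated by the `p`-th powers of the elements of `H`. -/
def powSubgroup {G : Type*} [Group G] (p : ℕ) (H : Subgroup G) : Subgroup G :=
  Subgroup.closure {g | ∃ h ∈ H, h ^ p = g}

theorem powSubgroup_normal {G : Type*} [Group G] (p : ℕ) (H : Subgroup G) (hH : H.Normal) :
    (powSubgroup p H).Normal := by
  refine ⟨fun n hn g => ?_⟩
  induction hn using Subgroup.closure_induction with
  | mem x hx =>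
    obtain ⟨h, hh, rfl⟩ := hx
    exact Subgroup.subset_closure ⟨g * h * g⁻¹, hH.conj_mem h hh g, conj_pow⟩
  | one => simp
  | mul a b _ _ ha hb =>
    have h := Subgroup.mul_mem _ ha hb
    rwa [show g * a * g⁻¹ * (g * b * g⁻¹) = g * (a * b) * g⁻¹ by group] at h
  | inv a _ ha =>
    have h := Subgroup.inv_mem _ ha
    rwa [show (g * a * g⁻¹)⁻¹ = g * a⁻¹ * g⁻¹ by group] at h

/-- The Frattini series of `G` for the prime `p`:
`Φ₀ = G` and `Φᵢ₊₁ = Φᵢ ^ p [Φᵢ, Φᵢ]`. -/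
def frattiniSeries (p : ℕ) (G : Type*) [Group G] : ℕ → Subgroup G
  | 0 => ⊤
  | i + 1 => powSubgroup p (frattiniSeries p G i) ⊔ ⁅frattiniSeries p G i, frattiniSeries p G i⁆

instance frattiniSeries_normal (p : ℕ) (G : Type*) [Group G] (i : ℕ) :
    (frattiniSeries p G i).Normal := by
  induction i with
  | zero => exact (inferInstance : (⊤ : Subgroup G).Normal)
  | succ i ih =>
    have := powSubgroup_normal p _ ih
    exact Subgroup.sup_normal _ _

/-- The factor group `Φᵢ / Φᵢ₊₁` of the Frattini series. -/
abbrev FrattiniFactor (p : ℕ) (G : Type*) [Group G] (i : ℕ) : Type _ :=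
  frattiniSeries p G i ⧸ (frattiniSeries p G (i + 1)).subgroupOf (frattiniSeries p G i)

/-- The Frattini series has length `l`: `l` is the least index with `Φ_l = 1`, i.e. the
non-trivial terms are precisely `Φ₀, …, Φ_{l-1}`. -/
def FrattiniLength (p : ℕ) (G : Type*) [Group G] (l : ℕ) : Prop :=
  IsLeast {n | frattiniSeries p G n = ⊥} l

/-- `Q` is a direct product of `r` cyclic groups of order `p`; the rank `r` is given as a
rational number, and it is part of the assertion that `r` is a natural number. -/
def IsElemAbelianOfRank (p : ℕ) (Q : Type*) [Group Q] (r : ℚ) : Prop :=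
  ∃ n : ℕ, (n : ℚ) = r ∧ Nonempty (Q ≃* Multiplicative (Fin n → ZMod p))

/-- The free generator `x` of the free group of rank two. -/
def freeX : FreeGroup (Fin 2) := FreeGroup.of 0
/-- The free generator `y` of the free group of rank two. -/
def freeY : FreeGroup (Fin 2) := FreeGroup.of 1
/-- `y_i = y ^ (x ^ i) = x ^ (-i) y x ^ i`. -/
def freeYi (i : ℕ) : FreeGroup (Fin 2) := (freeX ^ i)⁻¹ * freeY * freeX ^ i

/-- The defining relators of `G_k`. (The abstract group that they present is a finite `p`-group,
so it is also the pro-`p` group with this presentation.) The relators are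
`x ^ (p ^ (k+1))`, `y ^ (p ^ 2)`, `[x ^ (p ^ k), y]`, `[y ^ p, x]` and
`[y_0, y_i] ^ p`, `[y_0, y_i, x]`, `[y_0, y_i, y]` for `1 ≤ i ≤ (p ^ k - 1) / 2`. -/
def GkRels (p k : ℕ) : Set (FreeGroup (Fin 2)) :=
  {freeX ^ p ^ (k + 1), freeY ^ p ^ 2, gcomm (freeX ^ p ^ k) freeY, gcomm (freeY ^ p) freeX} ∪
  {r | ∃ i : ℕ, 1 ≤ i ∧ i ≤ (p ^ k - 1) / 2 ∧
    (r = gcomm (freeYi 0) (freeYi i) ^ p ∨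
     r = gcomm (gcomm (freeYi 0) (freeYi i)) freeX ∨
     r = gcomm (gcomm (freeYi 0) (freeYi i)) freeY)}

/-- The group `G_k`, given by its presentation on two generators. -/
abbrev Gk (p k : ℕ) : Type := PresentedGroup (GkRels p k)

/-- The generator `x` of `G_k`. -/
def Gk.x (p k : ℕ) : Gk p k := PresentedGroup.of 0
/-- The generator `y` of `G_k`. -/
def Gk.y (p k : ℕ) : Gk p k := PresentedGroup.of 1

/-- The element `[y, x, …, x]` of `G_k`, with `m` entries `x`. -/
def Gk.c (p k m : ℕ) : Gk p k := leftComm (Gk.y p k) (Gk.x p k) m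
/-- The element `[y, x, …, x, y]` of `G_k`, with `m` entries `x`. -/
def Gk.z (p k m : ℕ) : Gk p k := gcomm (Gk.c p k m) (Gk.y p k)

/-- `ν(j) = min {(p ^ j - 1) / (p - 1), p ^ k}`; the division is exact. -/
def nuFun (p k j : ℕ) : ℕ := min ((p ^ j - 1) / (p - 1)) (p ^ k)

/-! The normal closure of `y` in the presented group is nearly a Heisenberg group over the group
algebra `𝔽_p[C_{p^k}]`. With `t` the image of `x`, this algebra is `𝔽_p[X]/(X^{p^k})` for `X = t -
1`, a uniserial ring, so everything reduces to `X`-adic valuations. `Model` makes this explicit: `x`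
multiplies `f` by `t = 1 + X`, `y` is `f = 1`, and commutators of elements with `a = 0` are values
of twice the form `bar f * g - f * bar g`, where `bar` inverts `t`. These values are negated by
`bar`, hence have odd valuation. The coordinate `b` lifts the constant term of `f` and records the
central element `y^p`.

The model satisfies the relators (`relators_eq_one`) and is generated by the images of `x` and `y`
(`closure_gx_gy`). Conversely the relations bound the order of the presented group by that of the
model (`coveredBy_top_of_relations`), so the two are isomorphic (`exists_mulEquiv`).

In the model the Frattini series is a valuation filtration (`frattiniSeries_eq`). Commutation with
`x^{p^i}` multiplies `f` by `t^{p^i} - 1 = X^{p^i}`, so the valuation of `f` on the `i`-th term is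
at least `mu p i = 1 + p + ⋯ + p^{i-1}`; that of `c` is at least `2 * mu p (i - 1)`, as the form
adds valuations. Counting exponents gives the orders (`card_layer`). Since `[y, x, …, x]` with `m`
entries `x` has `f = X^m`, and `[y, x, …, x, y]` with `m` odd has `c` with leading term `-4 X^m`,
removing leading terms one by one gives the generators (`mem_of_forall_mem`). -/

namespace GkModel

open Polynomial in
/-- The truncated polynomial ring `𝔽_p[X] / (X ^ (p ^ k))`. -/
abbrev Trunc (p k : ℕ) : Type := AdjoinRoot ((X : (ZMod p)[X]) ^ p ^ k)

/-! ### The truncated polynomial ring: involution, form and `X`-adic filtrations -/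

section Ring

/-- The class of the variable. -/
noncomputable def xi (p k : ℕ) : Trunc p k := AdjoinRoot.root _

/-- The unit `1 + X`, by which the generator `x` acts. -/
noncomputable def tee (p k : ℕ) : Trunc p k := 1 + xi p k

/-- The inverse of `tee`. -/
noncomputable def teeInv (p k : ℕ) : Trunc p k := tee p k ^ (p ^ k - 1)

open Polynomial in
theorem xi_pow_top (p k : ℕ) : xi p k ^ p ^ k = 0 := by
  rw [xi, ← AdjoinRoot.mk_X, ← map_pow, AdjoinRoot.mk_self]

theorem xi_pow_eq_zero (p k : ℕ) {m : ℕ} (hm : p ^ k ≤ m) : xi p k ^ m = 0 :=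
  pow_eq_zero_of_le hm (xi_pow_top p k)

variable (p k : ℕ) [hp : Fact p.Prime]

open Polynomial in
theorem xi_pow_ne_zero {m : ℕ} (hm : m < p ^ k) : xi p k ^ m ≠ 0 := by
  rw [xi, ← AdjoinRoot.mk_X, ← map_pow]
  refine AdjoinRoot.mk_ne_zero_of_natDegree_lt (monic_X_pow _) (pow_ne_zero _ X_ne_zero) ?_
  simpa using hm

instance : Nontrivial (Trunc p k) :=
  ⟨⟨xi p k ^ 0, 0, xi_pow_ne_zero p k (pow_pos hp.out.pos k)⟩⟩

instance : CharP (Trunc p k) p :=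
  charP_of_injective_algebraMap (algebraMap (ZMod p) (Trunc p k)).injective p

theorem tee_pow_prime_pow (i : ℕ) : tee p k ^ p ^ i = 1 + xi p k ^ p ^ i := by
  rw [tee, add_pow_char_pow, one_pow]

theorem tee_pow_top : tee p k ^ p ^ k = 1 := by
  rw [tee_pow_prime_pow, xi_pow_top, add_zero]

theorem tee_mul_teeInv : tee p k * teeInv p k = 1 := by
  rw [teeInv, ← pow_succ', Nat.sub_add_cancel (pow_pos hp.out.pos k), tee_pow_top]

theorem teeInv_sub_one : teeInv p k - 1 = -(xi p k * teeInv p k) := by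
  have h := tee_mul_teeInv p k
  rw [tee] at h
  linear_combination h

open Polynomial in
/-- The involution of the truncated polynomial ring that inverts `1 + X`. -/
noncomputable def bar : Trunc p k →ₐ[ZMod p] Trunc p k :=
  AdjoinRoot.liftAlgHom _ (Algebra.ofId _ _) (teeInv p k - 1) (by
    rw [eval₂_pow, eval₂_X, teeInv_sub_one, neg_pow, mul_pow, xi_pow_top, zero_mul, mul_zero])

theorem bar_xi : bar p k (xi p k) = teeInv p k - 1 :=
  AdjoinRoot.liftAlgHom_root ..

theorem bar_xi' : bar p k (xi p k) = -(xi p k * teeInv p k) := by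
  rw [bar_xi, teeInv_sub_one]

theorem bar_tee : bar p k (tee p k) = teeInv p k := by
  rw [tee, map_add, map_one, bar_xi]; ring

theorem bar_teeInv : bar p k (teeInv p k) = tee p k := by
  have h := congrArg (bar p k) (tee_mul_teeInv p k)
  rw [map_mul, map_one, bar_tee] at h
  have h' := tee_mul_teeInv p k
  linear_combination tee p k * h - bar p k (teeInv p k) * h'

theorem bar_bar (f : Trunc p k) : bar p k (bar p k f) = f := by
  have : (bar p k).comp (bar p k) = AlgHom.id _ _ := by
    refine AdjoinRoot.algHom_ext ?_
    change bar p k (bar p k (xi p k)) = xi p k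
    rw [bar_xi, map_sub, map_one, bar_teeInv, tee]; ring
  exact DFunLike.congr_fun this f

open Polynomial in
/-- The constant term. -/
noncomputable def eps : Trunc p k →ₐ[ZMod p] ZMod p :=
  AdjoinRoot.liftAlgHom _ (Algebra.ofId _ _) 0 (by
    rw [eval₂_pow, eval₂_X, zero_pow (pow_pos hp.out.pos k).ne'])

theorem eps_xi : eps p k (xi p k) = 0 :=
  AdjoinRoot.liftAlgHom_root ..

theorem eps_tee : eps p k (tee p k) = 1 := by
  rw [tee, map_add, map_one, eps_xi, add_zero]

open Polynomial in
theorem xi_dvd_sub_eps (f : Trunc p k) : xi p k ∣ f - algebraMap _ _ (eps p k f) := by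
  induction f using AdjoinRoot.induction_on with
  | ih g =>
    have h1 : AdjoinRoot.mk (X ^ p ^ k) g
        = xi p k * AdjoinRoot.mk (X ^ p ^ k) g.divX
          + algebraMap (ZMod p) (Trunc p k) (g.coeff 0) := by
      conv_lhs => rw [← divX_mul_X_add g]
      rw [map_add, map_mul, AdjoinRoot.mk_X, mul_comm]; rfl
    have h2 : eps p k (AdjoinRoot.mk (X ^ p ^ k) g) = g.coeff 0 := by
      rw [h1, map_add, map_mul, eps_xi, zero_mul, zero_add, AlgHom.commutes]; rfl
    rw [h2, h1]
    exact ⟨_, add_sub_cancel_right _ _⟩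

theorem eps_eq_zero_iff (f : Trunc p k) : eps p k f = 0 ↔ xi p k ∣ f := by
  refine ⟨fun h => by simpa [h] using xi_dvd_sub_eps p k f, ?_⟩
  rintro ⟨g, rfl⟩
  rw [map_mul, eps_xi, zero_mul]

variable {p k}

/-- Leading coefficients for the `X`-adic filtration. -/
theorem exists_leading_coeff {r : ℕ} {f : Trunc p k} (hf : xi p k ^ r ∣ f) :
    ∃ s : ZMod p, xi p k ^ (r + 1) ∣ f - s • xi p k ^ r := by
  obtain ⟨g, rfl⟩ := hf
  obtain ⟨d, hd⟩ := xi_dvd_sub_eps p k g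
  refine ⟨eps p k g, d, ?_⟩
  rw [Algebra.smul_def]
  linear_combination xi p k ^ r * hd

/-- If `s ≠ 0`, then `X^r = X^{r+1} d`, so the unit `1 - X d` kills `X^r`, which is nonzero for `r <
p^k`. -/
theorem leading_coeff_eq_zero {r : ℕ} (hr : r < p ^ k) {s : ZMod p}
    (h : xi p k ^ (r + 1) ∣ s • xi p k ^ r) : s = 0 := by
  by_contra hs
  have h1 : xi p k ^ (r + 1) ∣ xi p k ^ r := by
    have := h.mul_left (algebraMap _ _ s⁻¹)
    rwa [← Algebra.smul_def, smul_smul, inv_mul_cancel₀ hs, one_smul] at this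
  obtain ⟨d, hd⟩ := h1
  have hn : IsNilpotent (xi p k * d) :=
    ⟨p ^ k, by rw [mul_pow, xi_pow_top, zero_mul]⟩
  have hu : IsUnit (1 - xi p k * d) := hn.isUnit_one_sub
  refine xi_pow_ne_zero p k hr ?_
  refine hu.mul_left_eq_zero.mp ?_
  linear_combination hd

theorem xi_pow_dvd_bar {r : ℕ} {f : Trunc p k} (hf : xi p k ^ r ∣ f) :
    xi p k ^ r ∣ bar p k f := by
  obtain ⟨g, rfl⟩ := hf
  rw [map_mul, map_pow, bar_xi', neg_pow, mul_pow]
  exact ⟨(-1) ^ r * teeInv p k ^ r * bar p k g, by ring⟩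

variable (p k) in
theorem xi_dvd_teeInv_pow_sub_one (r : ℕ) : xi p k ∣ teeInv p k ^ r - 1 := by
  refine dvd_trans ?_ (sub_one_dvd_pow_sub_one _ r)
  rw [teeInv_sub_one]
  exact ⟨-teeInv p k, by ring⟩

/-- The alternating form that describes the commutators. -/
noncomputable def form (f g : Trunc p k) : Trunc p k := bar p k f * g - f * bar p k g

theorem form_self (f : Trunc p k) : form f f = 0 := by rw [form, mul_comm, sub_self]

theorem form_add_left (f f' g : Trunc p k) : form (f + f') g = form f g + form f' g := by
  simp only [form, map_add]; ring

theorem form_add_right (f g g' : Trunc p k) : form f (g + g') = form f g + form f g' := by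
  simp only [form, map_add]; ring

theorem form_neg_left (f g : Trunc p k) : form (-f) g = -form f g := by
  simp only [form, map_neg]; ring

theorem bar_form (f g : Trunc p k) : bar p k (form f g) = -form f g := by
  simp only [form, map_sub, map_mul, bar_bar]; ring

/-- Powers of `t` have norm one, so the form is invariant under the action of `x`; associativity in
the model rests on this. -/
theorem form_mul_mul {u : Trunc p k} (hu : bar p k u * u = 1) (f g : Trunc p k) :
    form (u * f) (u * g) = form f g := by
  simp only [form, map_mul]
  linear_combination (bar p k f * g - f * bar p k g) * hu

theorem dvd_form {r s : ℕ} {f g : Trunc p k} (hf : xi p k ^ r ∣ f) (hg : xi p k ^ s ∣ g) :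
    xi p k ^ (r + s) ∣ form f g := by
  rw [form, pow_add]
  exact dvd_sub (mul_dvd_mul (xi_pow_dvd_bar hf) hg) (mul_dvd_mul hf (xi_pow_dvd_bar hg))

theorem dvd_form_left {r : ℕ} {f : Trunc p k} (hf : xi p k ^ r ∣ f) (g : Trunc p k) :
    xi p k ^ r ∣ form f g := by
  simpa using dvd_form (s := 0) hf (by simp : xi p k ^ 0 ∣ g)

theorem two_ne_zero_zmod (hp2 : p ≠ 2) : (2 : ZMod p) ≠ 0 := by
  intro h
  have : ((2 : ℕ) : ZMod p) = 0 := by exact_mod_cast h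
  rw [ZMod.natCast_eq_zero_iff] at this
  exact hp2 ((Nat.prime_dvd_prime_iff_eq hp.out Nat.prime_two).mp this)

/-- Since `bar X` has leading term `-X`, the involution multiplies a leading coefficient in degree
`r` by `(-1)^r`. For even `r` a negated element has `2s = 0`, hence `s = 0`. -/
theorem dvd_of_antisymm (hp2 : p ≠ 2) {r : ℕ} (hr : Even r) {f : Trunc p k} (hf : xi p k ^ r ∣ f)
    (hb : bar p k f = -f) : xi p k ^ (r + 1) ∣ f := by
  rcases le_or_gt (p ^ k) r with hrk | hrk
  · rw [xi_pow_eq_zero p k hrk, zero_dvd_iff] at hf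
    rw [hf]; exact dvd_zero _
  obtain ⟨s, g, hg⟩ := exists_leading_coeff hf
  have h1 : xi p k ^ (r + 1) ∣ bar p k (f - s • xi p k ^ r) := xi_pow_dvd_bar ⟨g, hg⟩
  obtain ⟨d, hd⟩ := h1
  obtain ⟨e, he⟩ := xi_dvd_teeInv_pow_sub_one p k r
  rw [map_sub, hb, map_smul, map_pow, bar_xi', hr.neg_pow, mul_pow] at hd
  have hs : s = 0 := by
    have h2 : xi p k ^ (r + 1) ∣ ((2 : ZMod p) * s) • xi p k ^ r := by
      refine ⟨-(d + g + algebraMap _ _ s * e), ?_⟩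
      rw [Algebra.smul_def] at hd hg ⊢
      rw [map_mul, map_ofNat]
      linear_combination -hd - hg - algebraMap _ _ s * xi p k ^ r * he
    exact (mul_eq_zero.mp (leading_coeff_eq_zero hrk h2)).resolve_left (two_ne_zero_zmod hp2)
  rw [hs, zero_smul, sub_zero] at hg
  exact ⟨g, hg⟩

/-- For odd `m` the commutator `[X ^ m, 1]` has leading term `-2 X ^ m`. -/
theorem dvd_form_xi_pow_one_add {m : ℕ} (hm : Odd m) :
    xi p k ^ (m + 1) ∣ form (xi p k ^ m) 1 + (2 : ZMod p) • xi p k ^ m := by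
  obtain ⟨e, he⟩ := xi_dvd_teeInv_pow_sub_one p k m
  refine ⟨-e, ?_⟩
  rw [form, map_one, map_pow, bar_xi', hm.neg_pow, mul_pow, Algebra.smul_def, map_ofNat]
  linear_combination -xi p k ^ m * he

variable (p k) in
/-- The multiples of `X ^ r`. -/
def fil (r : ℕ) : Submodule (ZMod p) (Trunc p k) where
  carrier := {f | xi p k ^ r ∣ f}
  add_mem' := dvd_add
  zero_mem' := dvd_zero _
  smul_mem' s f hf := by
    change xi p k ^ r ∣ s • f
    rw [Algebra.smul_def]
    exact hf.mul_left _

variable (p k) in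
/-- The multiples of `X ^ r` that the involution negates. -/
noncomputable def antiFil (r : ℕ) : Submodule (ZMod p) (Trunc p k) where
  carrier := {f | xi p k ^ r ∣ f ∧ bar p k f = -f}
  add_mem' := fun ha hb => ⟨dvd_add ha.1 hb.1, by rw [map_add, ha.2, hb.2]; ring⟩
  zero_mem' := ⟨dvd_zero _, by simp⟩
  smul_mem' s f hf := ⟨(fil p k r).smul_mem s hf.1, by rw [map_smul, hf.2, smul_neg]⟩

theorem mem_fil {r : ℕ} {f : Trunc p k} : f ∈ fil p k r ↔ xi p k ^ r ∣ f := Iff.rfl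

theorem fil_anti {r s : ℕ} (h : r ≤ s) : fil p k s ≤ fil p k r :=
  fun _ hf => (pow_dvd_pow _ h).trans hf

/-- Valuations from `p^k` on all mean zero; this accounts for the minimum in `nuFun`. -/
theorem fil_le_of_min_le {r s : ℕ} (h : min s (p ^ k) ≤ r) : fil p k r ≤ fil p k s := by
  intro f hf
  rcases min_le_iff.mp h with h | h
  · exact fil_anti h hf
  · rw [mem_fil, xi_pow_eq_zero p k h, zero_dvd_iff] at hf
    rw [hf]; exact zero_mem _

theorem form_mem_antiFil {r : ℕ} {f g : Trunc p k} (h : xi p k ^ r ∣ form f g) :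
    form f g ∈ antiFil p k r := ⟨h, bar_form f g⟩

/-- One step of a filtration: `S` is the direct sum of the line through `e` and `S'`. -/
theorem card_eq_mul_card {V : Type*} [AddCommGroup V] [Module (ZMod p) V]
    {S S' : Submodule (ZMod p) V} (hle : S' ≤ S) {e : V} (he : e ∈ S)
    (hex : ∀ f ∈ S, ∃ s : ZMod p, f - s • e ∈ S') (hinj : ∀ s : ZMod p, s • e ∈ S' → s = 0) :
    Nat.card S = p * Nat.card S' := by
  let φ : ZMod p × S' → S := fun a => ⟨a.1 • e + a.2, S.add_mem (S.smul_mem _ he) (hle a.2.2)⟩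
  have hφ : Function.Bijective φ := by
    constructor
    · rintro ⟨s, f, hf⟩ ⟨s', f', hf'⟩ h
      have h0 : s • e + f = s' • e + f' := congrArg Subtype.val h
      have h1 : (s - s') • e = f' - f := by
        rw [sub_smul, sub_eq_sub_iff_add_eq_add, h0, add_comm]
      have h2 : s = s' := sub_eq_zero.mp (hinj _ (h1 ▸ S'.sub_mem hf' hf))
      subst h2
      simpa using h0
    · rintro ⟨f, hf⟩
      obtain ⟨s, hs⟩ := hex f hf
      exact ⟨⟨s, ⟨_, hs⟩⟩, Subtype.ext (add_sub_cancel _ _)⟩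
  rw [← Nat.card_congr (Equiv.ofBijective φ hφ), Nat.card_prod, Nat.card_zmod]

theorem fil_top_eq_bot {r : ℕ} (h : p ^ k ≤ r) : fil p k r = ⊥ := by
  refine (Submodule.eq_bot_iff _).mpr fun f hf => ?_
  rwa [mem_fil, xi_pow_eq_zero p k h, zero_dvd_iff] at hf

theorem antiFil_anti {r s : ℕ} (h : r ≤ s) : antiFil p k s ≤ antiFil p k r :=
  fun _ hf => ⟨(pow_dvd_pow _ h).trans hf.1, hf.2⟩

theorem card_fil (r : ℕ) : Nat.card (fil p k r) = p ^ (p ^ k - r) := by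
  rcases le_total (p ^ k) r with h | h
  · rw [fil_top_eq_bot h, Nat.sub_eq_zero_of_le h, pow_zero, Nat.card_unique]
  induction h using Nat.decreasingInduction with
  | self => rw [fil_top_eq_bot le_rfl, Nat.sub_self, pow_zero, Nat.card_unique]
  | of_succ r hr ih =>
    rw [card_eq_mul_card (fil_anti r.le_succ) (e := xi p k ^ r) dvd_rfl
      (fun f hf => exists_leading_coeff hf) (fun s hs => leading_coeff_eq_zero hr hs), ih,
      ← pow_succ']
    congr 1; omega

/-- Odd leading exponents suffice for elements that the involution negates. -/
theorem exists_leading_coeff_antisymm (hp2 : p ≠ 2) {s : ℕ} {f : Trunc p k}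
    (hf : f ∈ antiFil p k (2 * s)) :
    ∃ c : ZMod p, f - c • form (xi p k ^ (2 * s + 1)) 1 ∈ antiFil p k (2 * s + 2) := by
  have hf1 := dvd_of_antisymm hp2 (even_two_mul s) hf.1 hf.2
  obtain ⟨c, hc⟩ := exists_leading_coeff hf1
  -- The form `form (X^{2s+1}) 1` has leading coefficient `-2`.
  refine ⟨-(c * 2⁻¹), ?_⟩
  have hodd : Odd (2 * s + 1) := odd_two_mul_add_one s
  have h2 := (dvd_form_xi_pow_one_add (p := p) (k := k) hodd)
  have h3 := (fil p k _).smul_mem (c * 2⁻¹) h2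
  refine ⟨?_, ?_⟩
  · have h4 : xi p k ^ (2 * s + 2) ∣ _ := dvd_add hc h3
    have h5 : (c * 2⁻¹ * 2 : ZMod p) = c := by
      rw [mul_assoc, inv_mul_cancel₀ (two_ne_zero_zmod hp2), mul_one]
    rw [smul_add, smul_smul, h5] at h4
    convert h4 using 1
    rw [neg_smul]; abel
  · rw [map_sub, hf.2, map_smul, bar_form, smul_neg]; abel

/-- Each odd exponent `2s+1, 2s+3, …, p^k - 2` contributes one factor `p`. -/
theorem card_antiFil (hp2 : p ≠ 2) {s : ℕ} (hs : 2 * s + 1 ≤ p ^ k) :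
    Nat.card (antiFil p k (2 * s)) = p ^ ((p ^ k - 1) / 2 - s) := by
  have hodd : Odd (p ^ k) := (hp.out.odd_of_ne_two hp2).pow
  have hs' : s ≤ (p ^ k - 1) / 2 := by omega
  clear hs
  induction hs' using Nat.decreasingInduction with
  | self =>
    have : antiFil p k (2 * ((p ^ k - 1) / 2)) = ⊥ := by
      refine (Submodule.eq_bot_iff _).mpr fun f hf => ?_
      have h1 := dvd_of_antisymm hp2 (even_two_mul _) hf.1 hf.2
      rwa [xi_pow_eq_zero p k (by have := hodd; rw [Nat.odd_iff] at this; omega),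
        zero_dvd_iff] at h1
    rw [this, Nat.sub_self, pow_zero, Nat.card_unique]
  | of_succ s hs ih =>
    have hodd : Odd (2 * s + 1) := odd_two_mul_add_one s
    rw [card_eq_mul_card (S' := antiFil p k (2 * (s + 1))) (e := form (xi p k ^ (2 * s + 1)) 1)
      (antiFil_anti (by omega))
      (form_mem_antiFil ((pow_dvd_pow _ (by omega)).trans (dvd_form_left dvd_rfl _)))
      (fun f hf => exists_leading_coeff_antisymm hp2 hf) ?_, ih, ← pow_succ']
    · congr 1; omega
    · intro c hc
      have h2 := (dvd_form_xi_pow_one_add (p := p) (k := k) hodd)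
      have h3 := dvd_sub ((fil p k _).smul_mem c h2) hc.1
      have h4 : xi p k ^ (2 * s + 1 + 1) ∣ (c * 2) • xi p k ^ (2 * s + 1) := by
        convert h3 using 1
        rw [smul_add, smul_smul]; abel
      exact (mul_eq_zero.mp (leading_coeff_eq_zero (by omega) h4)).resolve_right
        (two_ne_zero_zmod hp2)

end Ring

/-- The number of multiples of `p ^ i` in `ℤ / p ^ n`. -/
theorem card_zmod_dvd {p : ℕ} (hp : p.Prime) (n i : ℕ) :
    Nat.card {a : ZMod (p ^ n) // (p : ZMod (p ^ n)) ^ i ∣ a} = p ^ (n - i) := by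
  have h1 : Nat.card {a : ZMod (p ^ n) // (p : ZMod (p ^ n)) ^ i ∣ a}
      = Nat.card (AddSubgroup.zmultiples ((p ^ i : ℕ) : ZMod (p ^ n))) := by
    refine Nat.card_congr (Equiv.subtypeEquivRight fun a => ?_)
    rw [AddSubgroup.mem_zmultiples_iff]
    constructor
    · rintro ⟨b, rfl⟩
      obtain ⟨z, rfl⟩ := ZMod.intCast_surjective b
      exact ⟨z, by rw [zsmul_eq_mul, mul_comm]; push_cast; rfl⟩
    · rintro ⟨z, rfl⟩
      exact ⟨z, by rw [zsmul_eq_mul, mul_comm]; push_cast; rfl⟩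
  rw [h1, Nat.card_zmultiples, ZMod.addOrderOf_coe _ (pow_pos hp.pos n).ne']
  rcases le_total n i with h | h
  · rw [Nat.gcd_eq_left (pow_dvd_pow p h), Nat.div_self (pow_pos hp.pos n),
      Nat.sub_eq_zero_of_le h, pow_zero]
  · rw [Nat.gcd_eq_right (pow_dvd_pow p h), Nat.pow_div h hp.pos]


/-- The concrete group that is isomorphic to `Gk p k`: `a` and `b` are the exponent sums of `x`
and `y`, and `(f, c)` are coordinates of a twisted Heisenberg group over the truncated polynomial
ring, on which `x` acts by multiplication by `1 + X` on `f`. -/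
@[ext]
structure Model (p k : ℕ) [Fact p.Prime] where
  a : ZMod (p ^ (k + 1))
  b : ZMod (p ^ 2)
  f : Trunc p k
  c : Trunc p k
  eps_f : eps p k f = ZMod.castHom (dvd_pow_self p two_ne_zero) (ZMod p) b
  bar_c : bar p k c = -c

/-! ### The model group: action of `x`, group law, commutators and powers -/

section

/-- The action of the exponent `a` of `x`. -/
noncomputable def act (p k : ℕ) (a : ZMod (p ^ (k + 1))) : Trunc p k := tee p k ^ a.val

theorem act_zero {p k : ℕ} : act p k 0 = 1 := by rw [act, ZMod.val_zero, pow_zero]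

variable {p k : ℕ} [hp : Fact p.Prime]

variable (p k) in
theorem tee_pow_top_succ : tee p k ^ p ^ (k + 1) = 1 := by
  rw [pow_succ, pow_mul, tee_pow_top, one_pow]

instance : NeZero (p ^ (k + 1)) := ⟨(pow_pos hp.out.pos _).ne'⟩
instance : NeZero (p ^ 2) := ⟨(pow_pos hp.out.pos _).ne'⟩

theorem act_natCast (n : ℕ) : act p k n = tee p k ^ n := by
  rw [act, ZMod.val_natCast]
  exact (pow_eq_pow_mod n (tee_pow_top_succ p k)).symm

theorem act_one : act p k 1 = tee p k := by
  have := act_natCast (p := p) (k := k) 1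
  rwa [Nat.cast_one, pow_one] at this

theorem act_add (a a' : ZMod (p ^ (k + 1))) : act p k (a + a') = act p k a * act p k a' := by
  obtain ⟨n, rfl⟩ := ZMod.natCast_zmod_surjective a
  obtain ⟨m, rfl⟩ := ZMod.natCast_zmod_surjective a'
  rw [← Nat.cast_add, act_natCast, act_natCast, act_natCast, pow_add]

theorem act_neg_mul (a : ZMod (p ^ (k + 1))) : act p k (-a) * act p k a = 1 := by
  rw [← act_add, neg_add_cancel, act_zero]

theorem bar_act_mul (a : ZMod (p ^ (k + 1))) : bar p k (act p k a) * act p k a = 1 := by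
  rw [act, map_pow, bar_tee, ← mul_pow, mul_comm, tee_mul_teeInv, one_pow]

theorem eps_act (a : ZMod (p ^ (k + 1))) : eps p k (act p k a) = 1 := by
  rw [act, map_pow, eps_tee, one_pow]

theorem form_act (a : ZMod (p ^ (k + 1))) (f g : Trunc p k) :
    form (act p k a * f) (act p k a * g) = form f g := form_mul_mul (bar_act_mul a) f g

/-- By Frobenius `t^{p^i} - 1 = X^{p^i}`, and this divides `t^{p^i n} - 1`. -/
theorem xi_pow_dvd_act_sub_one {i : ℕ} {a : ZMod (p ^ (k + 1))}
    (h : (p : ZMod (p ^ (k + 1))) ^ i ∣ a) : xi p k ^ p ^ i ∣ act p k a - 1 := by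
  obtain ⟨b, rfl⟩ := h
  obtain ⟨n, rfl⟩ := ZMod.natCast_zmod_surjective b
  rw [← Nat.cast_pow, ← Nat.cast_mul, act_natCast, pow_mul, tee_pow_prime_pow]
  refine dvd_trans ?_ (sub_one_dvd_pow_sub_one _ n)
  rw [add_sub_cancel_left]

namespace Model

noncomputable instance : Mul (Model p k) where
  mul g h :=
    { a := g.a + h.a
      b := g.b + h.b
      f := act p k h.a * g.f + h.f
      c := g.c + h.c + form (act p k h.a * g.f) h.f
      eps_f := by rw [map_add, map_mul, eps_act, one_mul, map_add, g.eps_f, h.eps_f]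
      bar_c := by rw [map_add, map_add, bar_form, g.bar_c, h.bar_c]; ring }

noncomputable instance : One (Model p k) where
  one := ⟨0, 0, 0, 0, by simp, by simp⟩

noncomputable instance : Inv (Model p k) where
  inv g :=
    { a := -g.a
      b := -g.b
      f := -(act p k (-g.a) * g.f)
      c := -g.c
      eps_f := by rw [map_neg, map_mul, eps_act, one_mul, map_neg, g.eps_f]
      bar_c := by rw [map_neg, g.bar_c] }

@[simp] theorem one_a : (1 : Model p k).a = 0 := rfl
@[simp] theorem one_b : (1 : Model p k).b = 0 := rfl
@[simp] theorem one_f : (1 : Model p k).f = 0 := rfl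
@[simp] theorem one_c : (1 : Model p k).c = 0 := rfl
@[simp] theorem mul_a (g h : Model p k) : (g * h).a = g.a + h.a := rfl
@[simp] theorem mul_b (g h : Model p k) : (g * h).b = g.b + h.b := rfl
theorem mul_f (g h : Model p k) : (g * h).f = act p k h.a * g.f + h.f := rfl
theorem mul_c (g h : Model p k) :
    (g * h).c = g.c + h.c + form (act p k h.a * g.f) h.f := rfl
@[simp] theorem inv_a (g : Model p k) : g⁻¹.a = -g.a := rfl
@[simp] theorem inv_b (g : Model p k) : g⁻¹.b = -g.b := rfl
theorem inv_f (g : Model p k) : g⁻¹.f = -(act p k (-g.a) * g.f) := rfl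
@[simp] theorem inv_c (g : Model p k) : g⁻¹.c = -g.c := rfl

noncomputable instance : Group (Model p k) :=
  Group.ofLeftAxioms
    (fun g h l => by
      ext
      · simp only [mul_a, add_assoc]
      · simp only [mul_b, add_assoc]
      · simp only [mul_f, mul_a, act_add]; ring
      · simp only [mul_c, mul_f, mul_a, act_add, mul_add, form_add_left, form_add_right]
        rw [show act p k h.a * act p k l.a * g.f = act p k l.a * (act p k h.a * g.f) by ring,
          form_act]
        ring)
    (fun g => by
      ext
      · simp
      · simp
      · simp [mul_f]
      · simp [mul_c, form])
    (fun g => by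
      ext
      · simp
      · simp
      · rw [mul_f, inv_f, one_f]
        linear_combination -g.f * act_neg_mul g.a
      · rw [mul_c, inv_f, inv_c, one_c,
          show act p k g.a * -(act p k (-g.a) * g.f) = -g.f by
            linear_combination -g.f * act_neg_mul g.a, form_neg_left, form_self]
        ring)

theorem inv_mul_f {g h : Model p k} (hgh : g.a = h.a) : (g⁻¹ * h).f = h.f - g.f := by
  rw [mul_f, inv_f, ← hgh]
  linear_combination -g.f * act_neg_mul g.a

theorem inv_mul_c {g h : Model p k} (hgh : g.a = h.a) :
    (g⁻¹ * h).c = h.c - g.c - form g.f h.f := by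
  rw [mul_c, inv_f, inv_c, ← hgh, show act p k g.a * -(act p k (-g.a) * g.f) = -g.f by
    linear_combination -g.f * act_neg_mul g.a, form_neg_left]
  ring

theorem gcomm_eq (g h : Model p k) : gcomm g h = (h * g)⁻¹ * (g * h) := by
  rw [gcomm]; group

theorem gcomm_a (g h : Model p k) : (gcomm g h).a = 0 := by
  rw [gcomm_eq, mul_a, inv_a, mul_a, mul_a]; ring

theorem gcomm_b (g h : Model p k) : (gcomm g h).b = 0 := by
  rw [gcomm_eq, mul_b, inv_b, mul_b, mul_b]; ring

theorem gcomm_f (g h : Model p k) :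
    (gcomm g h).f = (act p k h.a - 1) * g.f - (act p k g.a - 1) * h.f := by
  rw [gcomm_eq, inv_mul_f (by simp only [mul_a]; ring), mul_f, mul_f]; ring

theorem gcomm_c (g h : Model p k) :
    (gcomm g h).c = form (act p k h.a * g.f) h.f - form (act p k g.a * h.f) g.f
      - form (act p k g.a * h.f + g.f) (act p k h.a * g.f + h.f) := by
  rw [gcomm_eq, inv_mul_c (by simp only [mul_a]; ring), mul_c, mul_c, mul_f, mul_f]; ring

theorem gcomm_c_of_a_eq_zero {g h : Model p k} (hg : g.a = 0) (hh : h.a = 0) :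
    (gcomm g h).c = 2 * form g.f h.f := by
  rw [gcomm_c, hg, hh, act_zero]
  simp only [one_mul, form]
  simp only [map_add]
  ring

/-- The generator `x`. -/
noncomputable def gx : Model p k := ⟨1, 0, 0, 0, by simp, by simp⟩

/-- The generator `y`. -/
noncomputable def gy : Model p k := ⟨0, 1, 1, 0, by simp, by simp⟩

theorem xi_dvd_f_of_b_eq_zero {g : Model p k} (h : g.b = 0) : xi p k ∣ g.f := by
  rw [← eps_eq_zero_iff, g.eps_f, h, map_zero]

@[simp] theorem gx_a : (gx : Model p k).a = 1 := rfl
@[simp] theorem gx_b : (gx : Model p k).b = 0 := rfl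
@[simp] theorem gx_f : (gx : Model p k).f = 0 := rfl
@[simp] theorem gx_c : (gx : Model p k).c = 0 := rfl

theorem gx_pow (n : ℕ) : (gx ^ n : Model p k).a = n ∧ (gx ^ n : Model p k).b = 0 ∧
    (gx ^ n : Model p k).f = 0 ∧ (gx ^ n : Model p k).c = 0 := by
  induction n with
  | zero => simp
  | succ n ih =>
    obtain ⟨h1, h2, h3, h4⟩ := ih
    simp [pow_succ, mul_f, mul_c, h1, h2, h3, h4, form]

@[simp] theorem gy_a : (gy : Model p k).a = 0 := rfl
@[simp] theorem gy_b : (gy : Model p k).b = 1 := rfl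
@[simp] theorem gy_f : (gy : Model p k).f = 1 := rfl
@[simp] theorem gy_c : (gy : Model p k).c = 0 := rfl

theorem gy_pow (n : ℕ) : (gy ^ n : Model p k).a = 0 ∧ (gy ^ n : Model p k).b = n ∧
    (gy ^ n : Model p k).f = n ∧ (gy ^ n : Model p k).c = 0 := by
  induction n with
  | zero => simp
  | succ n ih =>
    obtain ⟨h1, h2, h3, h4⟩ := ih
    simp [pow_succ, mul_f, mul_c, h1, h2, h3, h4, form, act_zero]

theorem pow_a (g : Model p k) (n : ℕ) : (g ^ n).a = n * g.a := by
  induction n with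
  | zero => simp
  | succ n ih => rw [pow_succ g, mul_a, ih]; push_cast; ring

theorem pow_b (g : Model p k) (n : ℕ) : (g ^ n).b = n * g.b := by
  induction n with
  | zero => simp
  | succ n ih => rw [pow_succ g, mul_b, ih]; push_cast; ring

theorem pow_f (g : Model p k) (n : ℕ) :
    (g ^ n).f = (∑ j ∈ Finset.range n, act p k g.a ^ j) * g.f := by
  induction n with
  | zero => simp
  | succ n ih => rw [pow_succ g, mul_f, ih, Finset.sum_range_succ', pow_zero, add_mul, one_mul,
      ← mul_assoc, Finset.mul_sum]; simp only [pow_succ']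

/-- Each further factor adds `g.c` and a form value of two multiples of `X^r`. -/
theorem dvd_pow_c {g : Model p k} {r : ℕ} (hg : xi p k ^ r ∣ g.f) (n : ℕ) :
    xi p k ^ (2 * r) ∣ (g ^ n).c - n * g.c := by
  induction n with
  | zero => simp
  | succ n ih =>
    have h1 : xi p k ^ r ∣ act p k g.a * (g ^ n).f := by
      rw [pow_f]; exact (hg.mul_left _).mul_left _
    have h2 := dvd_form h1 hg
    rw [← two_mul] at h2
    convert dvd_add ih h2 using 1
    rw [pow_succ g, mul_c]; push_cast; ring

theorem dvd_pow_prime_c {g : Model p k} {r : ℕ} (hg : xi p k ^ r ∣ g.f) :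
    xi p k ^ (2 * r) ∣ (g ^ p).c := by
  have := dvd_pow_c hg p
  rwa [CharP.cast_eq_zero, zero_mul, sub_zero] at this

/-- Taking the `p`-th power multiplies `f` by a sum of `p` powers of `act p k g.a`, each `1` modulo
`X^{p^i}`; the sum is therefore `p = 0` modulo `X^{p^i}`. -/
theorem dvd_pow_prime_f {g : Model p k} {i r : ℕ} (ha : (p : ZMod (p ^ (k + 1))) ^ i ∣ g.a)
    (hg : xi p k ^ r ∣ g.f) : xi p k ^ (r + p ^ i) ∣ (g ^ p).f := by
  rw [pow_f, add_comm, pow_add]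
  refine mul_dvd_mul ?_ hg
  have h1 : ∀ j, xi p k ^ p ^ i ∣ act p k g.a ^ j - 1 := fun j =>
    (xi_pow_dvd_act_sub_one ha).trans (sub_one_dvd_pow_sub_one _ j)
  have h2 := Finset.dvd_sum fun j (_ : j ∈ Finset.range p) => h1 j
  rwa [Finset.sum_sub_distrib, Finset.sum_const, Finset.card_range, nsmul_one,
    CharP.cast_eq_zero, sub_zero] at h2

end Model
end

/-- The sum `1 + p + ⋯ + p ^ (i - 1)`. -/
def mu (p i : ℕ) : ℕ := ∑ j ∈ Finset.range i, p ^ j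

theorem mu_zero (p : ℕ) : mu p 0 = 0 := rfl

theorem mu_one (p : ℕ) : mu p 1 = 1 := by simp [mu]

theorem mu_two (p : ℕ) : mu p 2 = 1 + p := by simp [mu, Finset.sum_range_succ]

theorem mu_succ (p i : ℕ) : mu p (i + 1) = mu p i + p ^ i := Finset.sum_range_succ ..

theorem mu_mono (p : ℕ) : Monotone (mu p) :=
  monotone_nat_of_le_succ fun i => by rw [mu_succ]; exact Nat.le_add_right _ _

theorem one_le_mu {p i : ℕ} (hi : 1 ≤ i) : 1 ≤ mu p i := by
  have := mu_mono p hi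
  rwa [mu_one] at this

theorem two_mul_mu_lt {p : ℕ} (hp : 3 ≤ p) (i : ℕ) : 2 * mu p i + 1 ≤ p ^ i := by
  induction i with
  | zero => simp [mu_zero]
  | succ i ih =>
    rw [mu_succ, pow_succ]
    nlinarith [Nat.mul_le_mul_left (p ^ i) hp]

/-! ### Valuations of the generators and the Frattini series of the model -/

section

variable {p k : ℕ} [hp : Fact p.Prime]

namespace Model

/-- Commutation with `x` multiplies `f` by `t - 1 = X`. The coordinate `c` is only an error term,
made of form values on multiples of `X^{m-1}`. -/
theorem leftComm_coords (m : ℕ) :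
    (leftComm gy gx m : Model p k).a = 0 ∧
    (leftComm gy gx m : Model p k).f = xi p k ^ m ∧
    xi p k ^ (2 * (m - 1)) ∣ (leftComm gy gx m : Model p k).c ∧
    (1 ≤ m → (leftComm gy gx m : Model p k).b = 0) := by
  induction m with
  | zero => simp [leftComm]
  | succ m ih =>
    obtain ⟨h1, h2, -, -⟩ := ih
    refine ⟨gcomm_a _ _, ?_, ?_, fun _ => gcomm_b _ _⟩
    · rw [leftComm, gcomm_f, h2, gx_a, gx_f, act_one, tee]; ring
    · rw [leftComm, gcomm_c, h2, gx_f, mul_zero, zero_add, add_zero, Nat.add_sub_cancel, two_mul]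
      refine dvd_sub (dvd_sub ?_ ?_) (dvd_form dvd_rfl (Dvd.intro_left _ rfl))
      · simp [form]
      · simp [form]

/-- The commutator `[y, x, …, x, y]` of the model. -/
noncomputable def gz (p k m : ℕ) [Fact p.Prime] : Model p k := gcomm (leftComm gy gx m) gy

theorem gz_coords (m : ℕ) : (gz p k m).a = 0 ∧ (gz p k m).b = 0 ∧ (gz p k m).f = 0 ∧
    (gz p k m).c = 2 * form (xi p k ^ m) 1 := by
  obtain ⟨h1, h2, -⟩ := leftComm_coords (p := p) (k := k) m
  refine ⟨gcomm_a _ _, gcomm_b _ _, ?_, ?_⟩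
  · rw [gz, gcomm_f, h1, gy_a, act_zero]; ring
  · rw [gz, gcomm_c_of_a_eq_zero h1 gy_a, h2, gy_f]

theorem pow_c_of_f_eq_zero {g : Model p k} (hg : g.f = 0) (n : ℕ) : (g ^ n).c = n * g.c := by
  have h := dvd_pow_c (g := g) (r := p ^ k) (by rw [hg]; exact dvd_zero _) n
  rwa [xi_pow_eq_zero p k (by omega), zero_dvd_iff, sub_eq_zero] at h

theorem pow_f_of_a_eq_zero {g : Model p k} (hg : g.a = 0) (n : ℕ) : (g ^ n).f = n * g.f := by
  rw [pow_f, hg, act_zero]; simp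

/-- Successive approximation in `c`: a power of `gz p k (2 * s + 1)` cancels the leading term of
degree `2s+1`, and the even degree above it needs no generator. -/
theorem mem_of_forall_gz_mem (hp2 : p ≠ 2) {K : Subgroup (Model p k)} {s₀ s₁ : ℕ}
    (hs : s₀ ≤ s₁)
    (hz : ∀ m, Odd m → 2 * s₀ + 1 ≤ m → m ≤ 2 * s₁ - 1 → gz p k m ∈ K)
    (hK : ∀ g : Model p k, g.a = 0 → g.b = 0 → g.f = 0 → xi p k ^ (2 * s₁) ∣ g.c → g ∈ K)
    (g : Model p k) (ha : g.a = 0) (hb : g.b = 0) (hf : g.f = 0)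
    (hc : xi p k ^ (2 * s₀) ∣ g.c) : g ∈ K := by
  induction hs using Nat.decreasingInduction generalizing g with
  | self => exact hK g ha hb hf hc
  | of_succ s hs ih =>
    obtain ⟨t, ht⟩ := exists_leading_coeff_antisymm hp2 (s := s) ⟨hc, g.bar_c⟩
    -- The halving compensates for the factor `2` in the coordinate `c` of `gz`.
    obtain ⟨n, hn⟩ := ZMod.natCast_zmod_surjective (-(t * 2⁻¹))
    obtain ⟨h1, h2, h3, h4⟩ := gz_coords (p := p) (k := k) (2 * s + 1)
    have hzK := hz (2 * s + 1) (odd_two_mul_add_one s) le_rfl (by omega)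
    refine (K.mul_mem_cancel_right (K.pow_mem hzK n)).mp
      (ih (fun m h h' h'' => hz m h (by omega) h'') _ ?_ ?_ ?_ ?_)
    · rw [mul_a, pow_a, ha, h1]; ring
    · rw [mul_b, pow_b, hb, h2]; ring
    · rw [mul_f, pow_f, hf, h3]; ring
    · rw [mul_c, hf, pow_c_of_f_eq_zero h3, h4]
      have h5 : (n : Trunc p k) * 2 = -algebraMap _ _ t := by
        have : algebraMap (ZMod p) (Trunc p k) (n * 2) = -algebraMap _ _ t := by
          rw [← map_neg, hn, neg_mul, mul_assoc, inv_mul_cancel₀ (two_ne_zero_zmod hp2), mul_one]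
        rwa [map_mul, map_natCast, map_ofNat] at this
      have h6 : xi p k ^ (2 * (s + 1)) ∣ _ := ht.1
      rw [Algebra.smul_def] at h6
      convert h6 using 1
      simp only [mul_zero, form, map_zero, zero_mul, sub_zero, add_zero]
      linear_combination (bar p k (xi p k ^ (2 * s + 1)) * 1 - xi p k ^ (2 * s + 1) * bar p k 1) * h5

/-- The same approximation in `f`. The bound `s ≤ 2 * (r₀ - 1)` ensures that the error terms in `c`
of the correcting factors do not spoil divisibility by `X^s`. -/
theorem mem_of_forall_leftComm_mem {K : Subgroup (Model p k)} {r₀ r₁ s : ℕ} (hr₀ : 1 ≤ r₀)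
    (hr : r₀ ≤ r₁) (hs : s ≤ 2 * (r₀ - 1)) (hc : ∀ m, r₀ ≤ m → m < r₁ → leftComm gy gx m ∈ K)
    (hK : ∀ g : Model p k, g.a = 0 → g.b = 0 → xi p k ^ r₁ ∣ g.f → xi p k ^ s ∣ g.c → g ∈ K)
    (g : Model p k) (ha : g.a = 0) (hb : g.b = 0) (hf : xi p k ^ r₀ ∣ g.f)
    (hgc : xi p k ^ s ∣ g.c) : g ∈ K := by
  induction hr using Nat.decreasingInduction generalizing g with
  | self => exact hK g ha hb hf hgc
  | of_succ r hr ih =>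
    obtain ⟨t, ht⟩ := exists_leading_coeff hf
    obtain ⟨n, hn⟩ := ZMod.natCast_zmod_surjective (-t)
    obtain ⟨h1, h2, h3, h4⟩ := leftComm_coords (p := p) (k := k) r
    have hcK := hc r le_rfl hr
    refine (K.mul_mem_cancel_right (K.pow_mem hcK n)).mp
      (ih (by omega) (by omega) (fun m h h' => hc m (by omega) h') _ ?_ ?_ ?_ ?_)
    · rw [mul_a, pow_a, ha, h1]; ring
    · rw [mul_b, pow_b, hb, h4 hr₀]; ring
    · rw [mul_f, pow_a, h1, mul_zero, act_zero, pow_f_of_a_eq_zero h1, h2]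
      rw [Algebra.smul_def] at ht
      have h5 : (n : Trunc p k) = -algebraMap _ _ t := by
        rw [← map_neg, ← hn, map_natCast]
      convert ht using 1
      rw [h5]; ring
    · rw [mul_c]
      refine dvd_add (dvd_add hgc ?_) ((pow_dvd_pow _ ?_).trans
        (dvd_form (hf.mul_left _) (s := r) ?_))
      · have h5 := dvd_pow_c (r := r) (by rw [h2] : xi p k ^ r ∣ (leftComm gy gx r : Model p k).f) n
        have h6 := dvd_add ((pow_dvd_pow _ (by omega)).trans h5)
          (((pow_dvd_pow _ hs).trans h3).mul_left (n : Trunc p k))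
        rwa [sub_add_cancel] at h6
      · omega
      · rw [pow_f_of_a_eq_zero h1, h2]; exact dvd_mul_left _ _

theorem mem_of_forall_mem (hp2 : p ≠ 2) {K : Subgroup (Model p k)} {r₀ r₁ s₀ s₁ : ℕ}
    (hr₀ : 1 ≤ r₀) (hr : r₀ ≤ r₁) (hs : s₀ ≤ s₁) (hrs : s₀ + 1 ≤ r₀)
    (hc : ∀ m, r₀ ≤ m → m < r₁ → leftComm gy gx m ∈ K)
    (hz : ∀ m, Odd m → 2 * s₀ + 1 ≤ m → m ≤ 2 * s₁ - 1 → gz p k m ∈ K)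
    (hK : ∀ g : Model p k, g.a = 0 → g.b = 0 → xi p k ^ r₁ ∣ g.f →
      xi p k ^ (2 * s₁) ∣ g.c → g ∈ K)
    (g : Model p k) (ha : g.a = 0) (hb : g.b = 0) (hf : xi p k ^ r₀ ∣ g.f)
    (hgc : xi p k ^ (2 * s₀) ∣ g.c) : g ∈ K := by
  refine mem_of_forall_leftComm_mem (s := 2 * s₀) hr₀ hr (by omega) hc ?_ g ha hb hf hgc
  clear g ha hb hf hgc
  intro g ha hb hf hgc
  -- This element of `K` carries the whole coordinate `f` of `g`, so that `h⁻¹ * g` has only a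
  -- coordinate `c`.
  let h : Model p k := ⟨0, 0, g.f, 0, by rw [g.eps_f, hb], by simp⟩
  have hh : h ∈ K := hK h rfl rfl hf (dvd_zero _)
  have hah : h.a = g.a := ha.symm
  refine (K.mul_mem_cancel_left (K.inv_mem hh)).mp
    (mem_of_forall_gz_mem hp2 hs hz (fun g ha hb hf hc => hK g ha hb (by simp [hf]) hc) _ ?_ ?_ ?_ ?_)
  · rw [mul_a, inv_a, hah]; ring
  · rw [mul_b, inv_b, hb]; change -0 + 0 = _; ring
  · rw [inv_mul_f hah]; exact sub_self _
  · rw [inv_mul_c hah]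
    change _ ∣ g.c - 0 - form g.f g.f
    rwa [form_self, sub_zero, sub_zero]

/-- The subgroup that turns out to be the `i`-th term of the Frattini series. -/
def layer (p k i : ℕ) [Fact p.Prime] : Subgroup (Model p k) where
  carrier := {g | (p : ZMod (p ^ (k + 1))) ^ i ∣ g.a ∧ (p : ZMod (p ^ 2)) ^ i ∣ g.b ∧
    xi p k ^ mu p i ∣ g.f ∧ xi p k ^ (2 * mu p (i - 1)) ∣ g.c}
  mul_mem' {g h} hg hh := by
    refine ⟨dvd_add hg.1 hh.1, dvd_add hg.2.1 hh.2.1,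
      dvd_add (hg.2.2.1.mul_left _) hh.2.2.1, dvd_add (dvd_add hg.2.2.2 hh.2.2.2) ?_⟩
    refine (pow_dvd_pow _ ?_).trans (dvd_form (hg.2.2.1.mul_left _) hh.2.2.1)
    have := mu_mono p (Nat.sub_le i 1)
    omega
  one_mem' := ⟨dvd_zero _, dvd_zero _, dvd_zero _, dvd_zero _⟩
  inv_mem' {g} hg := ⟨hg.1.neg_right, hg.2.1.neg_right, (hg.2.2.1.mul_left _).neg_right,
    hg.2.2.2.neg_right⟩

theorem mem_layer {i : ℕ} {g : Model p k} : g ∈ layer p k i ↔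
    (p : ZMod (p ^ (k + 1))) ^ i ∣ g.a ∧ (p : ZMod (p ^ 2)) ^ i ∣ g.b ∧
    xi p k ^ mu p i ∣ g.f ∧ xi p k ^ (2 * mu p (i - 1)) ∣ g.c := Iff.rfl

theorem gx_pow_mem_layer (i : ℕ) : gx ^ p ^ i ∈ layer p k i := by
  obtain ⟨h1, h2, h3, h4⟩ := gx_pow (p := p) (k := k) (p ^ i)
  rw [mem_layer, h1, h2, h3, h4]
  exact ⟨by rw [Nat.cast_pow], dvd_zero _, dvd_zero _, dvd_zero _⟩

theorem gy_pow_mem_layer (i : ℕ) : gy ^ p ^ i ∈ layer p k i := by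
  obtain ⟨h1, h2, h3, h4⟩ := gy_pow (p := p) (k := k) (p ^ i)
  rw [mem_layer, h1, h2, h3, h4]
  refine ⟨dvd_zero _, by rw [Nat.cast_pow], ?_, dvd_zero _⟩
  rcases i with _ | i
  · simp [mu_zero]
  · rw [Nat.cast_pow, CharP.cast_eq_zero, zero_pow (Nat.succ_ne_zero i)]
    exact dvd_zero _

theorem layer_le {K : Subgroup (Model p k)} {i : ℕ} (hx : gx ^ p ^ i ∈ K) (hy : gy ^ p ^ i ∈ K)
    (hK : ∀ g ∈ layer p k i, g.a = 0 → g.b = 0 → g ∈ K) : layer p k i ≤ K := by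
  intro g hg
  obtain ⟨a, ha⟩ := hg.1
  obtain ⟨n, rfl⟩ := ZMod.natCast_zmod_surjective a
  obtain ⟨b, hb⟩ := hg.2.1
  obtain ⟨m, rfl⟩ := ZMod.natCast_zmod_surjective b
  have h1 : ((gy ^ p ^ i) ^ m)⁻¹ * (((gx ^ p ^ i) ^ n)⁻¹ * g) ∈ K := by
    refine hK _ ?_ ?_ ?_
    · exact mul_mem (inv_mem (pow_mem (gy_pow_mem_layer i) m))
        (mul_mem (inv_mem (pow_mem (gx_pow_mem_layer i) n)) hg)
    · simp only [mul_a, inv_a, pow_a, gx_a, gy_a, ha]; push_cast; ring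
    · simp only [mul_b, inv_b, pow_b, gx_b, gy_b, hb]; push_cast; ring
  rwa [K.mul_mem_cancel_left (K.inv_mem (K.pow_mem hy m)),
    K.mul_mem_cancel_left (K.inv_mem (K.pow_mem hx n))] at h1

theorem pow_prime_mem_layer {i : ℕ} {g : Model p k} (hg : g ∈ layer p k i) :
    g ^ p ∈ layer p k (i + 1) := by
  refine ⟨?_, ?_, ?_, dvd_pow_prime_c hg.2.2.1⟩
  · rw [pow_a, pow_succ' _ i]; exact mul_dvd_mul_left _ hg.1
  · rw [pow_b, pow_succ' _ i]; exact mul_dvd_mul_left _ hg.2.1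
  · rw [mu_succ]; exact dvd_pow_prime_f hg.1 hg.2.2.1

/-- In `f`, one factor gives `X^{mu p i}` and the action of the other gives `X^{p^i}`; in `c`, the
form doubles the valuation `mu p i`. -/
theorem gcomm_mem_layer {i : ℕ} {g h : Model p k} (hg : g ∈ layer p k i)
    (hh : h ∈ layer p k i) : gcomm g h ∈ layer p k (i + 1) := by
  refine ⟨by rw [gcomm_a]; exact dvd_zero _, by rw [gcomm_b]; exact dvd_zero _, ?_, ?_⟩
  · rw [gcomm_f, mu_succ, add_comm, pow_add]
    exact dvd_sub (mul_dvd_mul (xi_pow_dvd_act_sub_one hh.1) hg.2.2.1)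
      (mul_dvd_mul (xi_pow_dvd_act_sub_one hg.1) hh.2.2.1)
  · rw [gcomm_c, Nat.add_sub_cancel, two_mul]
    have h1 := hg.2.2.1.mul_left (act p k h.a)
    have h2 := hh.2.2.1.mul_left (act p k g.a)
    exact dvd_sub (dvd_sub (dvd_form h1 hh.2.2.1) (dvd_form h2 hg.2.2.1))
      (dvd_form (dvd_add h2 hg.2.2.1) (dvd_add h1 hh.2.2.1))

/-- An element with trivial exponent of `x` and prescribed coordinate `f`. -/
noncomputable def ofTrunc (f : Trunc p k) : Model p k :=
  ⟨0, (eps p k f).val, f, 0, by rw [map_natCast, ZMod.natCast_zmod_val], by simp⟩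

theorem ofTrunc_mem_layer {i : ℕ} {f : Trunc p k} (hf : xi p k ^ mu p i ∣ f) :
    ofTrunc f ∈ layer p k i := by
  refine ⟨dvd_zero _, ?_, hf, dvd_zero _⟩
  rcases i with _ | i
  · simp
  · have h1 : xi p k ∣ f :=
      (dvd_pow_self _ (by have := one_le_mu (p := p) (Nat.le_add_left 1 i); omega)).trans hf
    change _ ∣ (((eps p k f).val : ℕ) : ZMod (p ^ 2))
    rw [(eps_eq_zero_iff p k f).mpr h1, ZMod.val_zero, Nat.cast_zero]
    exact dvd_zero _

end Model

/-- Every negated multiple of `X ^ (2 * r)` is a commutator. -/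
theorem exists_two_mul_form_eq (hp2 : p ≠ 2) {r : ℕ} {c : Trunc p k}
    (hc : c ∈ antiFil p k (2 * r)) : ∃ d, c = 2 * form (xi p k ^ r) (xi p k ^ r * d) := by
  obtain ⟨⟨e, he⟩, hb⟩ := hc
  obtain ⟨u, hu, hu2⟩ : ∃ u : Trunc p k, bar p k u = u ∧ 2 * u = 1 := by
    refine ⟨algebraMap _ _ 2⁻¹, AlgHom.commutes _ _, ?_⟩
    have := congrArg (algebraMap (ZMod p) (Trunc p k)) (mul_inv_cancel₀ (two_ne_zero_zmod hp2))
    rwa [map_mul, map_ofNat, map_one] at this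
  -- The norm of `X^r` is a `bar`-invariant associate of `X^{2r}`. Writing `c = w e'`, antisymmetry
  -- gives `w * bar e' = -w e'`, so `d = e'/4` solves the equation.
  obtain ⟨w, hw⟩ : ∃ w, w = bar p k (xi p k ^ r) * xi p k ^ r := ⟨_, rfl⟩
  have hbw : bar p k w = w := by rw [hw, map_mul, bar_bar, mul_comm]
  obtain ⟨e', he'⟩ : ∃ e', c = w * e' := by
    refine ⟨(-1) ^ r * tee p k ^ r * e, ?_⟩
    have h1 : teeInv p k ^ r * tee p k ^ r = 1 := by
      rw [← mul_pow, mul_comm, tee_mul_teeInv, one_pow]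
    have h2 : ((-1 : Trunc p k) ^ r) * (-1) ^ r = 1 := by rw [← mul_pow]; simp
    rw [hw, map_pow, bar_xi', neg_pow, mul_pow, he]
    linear_combination (-xi p k ^ (2 * r) * e) * h1
      - (xi p k ^ (2 * r) * e * teeInv p k ^ r * tee p k ^ r) * h2
  refine ⟨u * u * e', ?_⟩
  rw [he', map_mul, hbw] at hb
  rw [he', form, map_mul, map_mul, map_mul, hu]
  have h3 : xi p k ^ r * (bar p k (xi p k ^ r) * (u * u * bar p k e'))
    = w * (u * u * bar p k e') := by rw [hw]; ring
  have h4 : bar p k (xi p k ^ r) * (xi p k ^ r * (u * u * e')) = w * (u * u * e') := by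
    rw [hw]; ring
  rw [h3, h4]
  linear_combination (2 * u * u) * hb - (w * e' * (2 * u + 1)) * hu2

namespace Model

/-- For the harder inclusion, `p`-th powers are needed only for powers of `x` and `y`. When `a = b =
0`, commutation with `x^{p^i}` realises `f`, and the remaining `c` is itself a commutator by
`exists_two_mul_form_eq`. -/
theorem frattiniSeries_eq (hp2 : p ≠ 2) (i : ℕ) :
    frattiniSeries p (Model p k) i = layer p k i := by
  induction i with
  | zero =>
    refine (Subgroup.eq_top_iff' _).mpr (fun g => ?_) |>.symm
    simp [mem_layer, mu_zero]
  | succ i ih =>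
    rw [frattiniSeries, ih]
    refine le_antisymm (sup_le ?_ ?_) ?_
    · refine (Subgroup.closure_le _).mpr ?_
      rintro _ ⟨g, hg, rfl⟩
      exact pow_prime_mem_layer hg
    · refine Subgroup.commutator_le.mpr fun g hg h hh => ?_
      have := gcomm_mem_layer (inv_mem hg) (inv_mem hh)
      -- The two conventions differ by inversion: `gcomm g h = ⁅g⁻¹, h⁻¹⁆`.
      simpa [gcomm, commutatorElement_def] using this
    · have hpow : ∀ g ∈ layer p k i, g ^ p ∈ powSubgroup p (layer p k i)
          ⊔ ⁅layer p k i, layer p k i⁆ := fun g hg =>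
        (le_sup_left : powSubgroup p (layer p k i) ≤ _) (Subgroup.subset_closure ⟨g, hg, rfl⟩)
      have hcomm : ∀ g ∈ layer p k i, ∀ h ∈ layer p k i, gcomm g h ∈ powSubgroup p (layer p k i)
          ⊔ ⁅layer p k i, layer p k i⁆ := fun g hg h hh => by
        have := Subgroup.commutator_mem_commutator (inv_mem hg) (inv_mem hh)
        refine (le_sup_right : ⁅layer p k i, layer p k i⁆ ≤ _) ?_
        simpa [gcomm, commutatorElement_def] using this
      refine layer_le ?_ ?_ ?_
      · rw [pow_succ, pow_mul]; exact hpow _ (gx_pow_mem_layer i)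
      · rw [pow_succ, pow_mul]; exact hpow _ (gy_pow_mem_layer i)
      intro g hg ha hb
      obtain ⟨d, hd⟩ := hg.2.2.1
      have hdm := ofTrunc_mem_layer (p := p) (k := k) (i := i) (dvd_mul_right _ d)
      have h1 := hcomm _ hdm _ (gx_pow_mem_layer i)
      have h1' := gcomm_mem_layer hdm (gx_pow_mem_layer i)
      have h1f := gcomm_f (ofTrunc (xi p k ^ mu p i * d)) (gx ^ p ^ i)
      have h1a := gcomm_a (ofTrunc (xi p k ^ mu p i * d)) (gx ^ p ^ i)
      have h1b := gcomm_b (ofTrunc (xi p k ^ mu p i * d)) (gx ^ p ^ i)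
      rw [(gx_pow _).1, act_natCast, tee_pow_prime_pow, (gx_pow _).2.2.1, mul_zero, sub_zero] at h1f
      generalize gcomm (ofTrunc (xi p k ^ mu p i * d)) (gx ^ p ^ i) = u at *
      have hfu : u.f = g.f := by
        rw [h1f, hd, mu_succ]; change _ * (_ * d) = _; ring
      refine (Subgroup.mul_mem_cancel_left _ (inv_mem h1)).mp ?_
      have hau : u.a = g.a := by rw [h1a, ha]
      have h2 := mul_mem (inv_mem h1') hg
      have h2f : (u⁻¹ * g).f = 0 := by rw [inv_mul_f hau, hfu, sub_self]
      have h2a : (u⁻¹ * g).a = 0 := by rw [mul_a, inv_a, hau]; ring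
      have h2b : (u⁻¹ * g).b = 0 := by rw [mul_b, inv_b, h1b, hb]; ring
      generalize u⁻¹ * g = v at *
      obtain ⟨e, he⟩ := exists_two_mul_form_eq hp2 (r := mu p i) ⟨h2.2.2.2, v.bar_c⟩
      convert hcomm _ (ofTrunc_mem_layer (i := i) dvd_rfl) _
        (ofTrunc_mem_layer (i := i) (dvd_mul_right _ e))
      ext
      · rw [gcomm_a, h2a]
      · rw [gcomm_b, h2b]
      · rw [gcomm_f, h2f]; change 0 = (act p k 0 - 1) * _ - (act p k 0 - 1) * _
        rw [act_zero]; ring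
      · rw [gcomm_c_of_a_eq_zero rfl rfl, he]; rfl

/-- Subtracting a lift of `b` from `f` makes the four coordinates independent. The difference is
always a multiple of `X`, whence the `max 1`, which matters only for `i = 0`. -/
theorem card_layer (hp2 : p ≠ 2) {i : ℕ} (hi : i ≤ k + 1) :
    Nat.card (layer p k i) = p ^ ((k + 1 - i) + (2 - i) + (p ^ k - max 1 (mu p i)) +
      ((p ^ k - 1) / 2 - mu p (i - 1))) := by
  have hlift : ∀ b : ZMod (p ^ 2), eps p k (b.val : Trunc p k)
      = ZMod.castHom (dvd_pow_self p two_ne_zero) (ZMod p) b := fun b => by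
    conv_rhs => rw [← ZMod.natCast_zmod_val b]
    rw [map_natCast, map_natCast]
  have hlift' : ∀ b : ZMod (p ^ 2), (p : ZMod (p ^ 2)) ^ i ∣ b →
      xi p k ^ mu p i ∣ (b.val : Trunc p k) := fun b hb => by
    rcases i with _ | i
    · simp [mu_zero]
    · have h1 : ((b.val : ℕ) : ZMod p) = 0 := by
        have h2 : ((b.val : ℕ) : ZMod p) = eps p k (b.val : Trunc p k) := by rw [map_natCast]
        obtain ⟨d, rfl⟩ := hb
        rw [h2, hlift, map_mul, map_pow, map_natCast, CharP.cast_eq_zero,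
          zero_pow (Nat.succ_ne_zero i), zero_mul]
      rw [ZMod.natCast_eq_zero_iff] at h1
      rw [(CharP.cast_eq_zero_iff (Trunc p k) p _).mpr h1]
      exact dvd_zero _
  let e : layer p k i ≃ {a : ZMod (p ^ (k + 1)) // (p : ZMod (p ^ (k + 1))) ^ i ∣ a} ×
      {b : ZMod (p ^ 2) // (p : ZMod (p ^ 2)) ^ i ∣ b} ×
      fil p k (max 1 (mu p i)) × antiFil p k (2 * mu p (i - 1)) :=
    { toFun := fun g => ⟨⟨g.1.a, g.2.1⟩, ⟨g.1.b, g.2.2.1⟩, ⟨g.1.f - (g.1.b.val : Trunc p k), by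
          rw [mem_fil]
          rcases le_total 1 (mu p i) with h | h
          · rw [max_eq_right h]
            exact dvd_sub g.2.2.2.1 (hlift' _ g.2.2.1)
          · rw [max_eq_left h, pow_one, ← eps_eq_zero_iff, map_sub, hlift, g.1.eps_f, sub_self]⟩,
        ⟨g.1.c, g.2.2.2.2, g.1.bar_c⟩⟩
      invFun := fun q => ⟨⟨q.1.1, q.2.1.1, q.2.2.1.1 + (q.2.1.1.val : Trunc p k), q.2.2.2.1, by
          have h1 : xi p k ∣ q.2.2.1.1 :=
            (dvd_pow_self _ (by omega)).trans (mem_fil.mp q.2.2.1.2)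
          rw [map_add, (eps_eq_zero_iff p k _).mpr h1, hlift, zero_add], q.2.2.2.2.2⟩,
        q.1.2, q.2.1.2, dvd_add ((pow_dvd_pow _ (le_max_right _ _)).trans q.2.2.1.2)
          (hlift' _ q.2.1.2), q.2.2.2.2.1⟩
      left_inv := fun g => by
        ext <;> simp
      right_inv := fun q => by
        ext <;> simp }
  have hp3 : 3 ≤ p := by
    have := hp.out.two_le
    omega
  have hmu : 2 * mu p (i - 1) + 1 ≤ p ^ k :=
    (two_mul_mu_lt hp3 (i - 1)).trans (Nat.pow_le_pow_right hp.out.pos (by omega))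
  rw [Nat.card_congr e, Nat.card_prod, Nat.card_prod, Nat.card_prod, card_zmod_dvd hp.out,
    card_zmod_dvd hp.out, card_fil, card_antiFil hp2 hmu, ← pow_add, ← pow_add, ← pow_add]
  congr 1
  omega

end Model
end
end GkModel

/-! ### Bounding the order of a group that satisfies the relations -/

section Cover

variable {G : Type*} [Group G]

theorem gcomm_eq_one_iff {a b : G} : gcomm a b = 1 ↔ a * b = b * a := by
  rw [gcomm, mul_assoc, ← mul_inv_rev, inv_mul_eq_one, eq_comm]

theorem inv_gcomm (a b : G) : (gcomm a b)⁻¹ = gcomm b a := by simp only [gcomm]; group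

theorem conj_gcomm (g a b : G) :
    g⁻¹ * gcomm a b * g = gcomm (g⁻¹ * a * g) (g⁻¹ * b * g) := by simp only [gcomm]; group

theorem map_gcomm {H : Type*} [Group H] (φ : G →* H) (a b : G) :
    φ (gcomm a b) = gcomm (φ a) (φ b) := by simp [gcomm]

theorem map_leftComm {H : Type*} [Group H] (φ : G →* H) (y x : G) (m : ℕ) :
    φ (leftComm y x m) = leftComm (φ y) (φ x) m := by
  induction m with
  | zero => rfl
  | succ m ih => rw [leftComm, map_gcomm, ih, leftComm]

theorem conj_mem_closure {S : Set G} {g : G}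
    (h : ∀ s ∈ S, g⁻¹ * s * g ∈ Subgroup.closure S) {u : G} (hu : u ∈ Subgroup.closure S) :
    g⁻¹ * u * g ∈ Subgroup.closure S := by
  have : Subgroup.closure S ≤ (Subgroup.closure S).comap (MulAut.conj g⁻¹).toMonoidHom := by
    refine (Subgroup.closure_le _).mpr fun s hs => ?_
    simpa using h s hs
  simpa using this hu

/-- Conjugation by `g⁻¹` is conjugation by `g^{n-1}` after an inner automorphism of `H`, so one
direction of invariance suffices. -/
theorem mem_normalizer_of_pow_mem {H : Subgroup G} {g : G} {n : ℕ} (hn : 0 < n) (hg : g ^ n ∈ H)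
    (h : ∀ u ∈ H, g⁻¹ * u * g ∈ H) : g ∈ Subgroup.normalizer (H : Set G) := by
  have hpow : ∀ m : ℕ, ∀ u ∈ H, (g ^ m)⁻¹ * u * g ^ m ∈ H := fun m => by
    induction m with
    | zero => intro u hu; simpa using hu
    | succ m ih =>
      intro u hu
      have := h _ (ih u hu)
      rwa [show g⁻¹ * ((g ^ m)⁻¹ * u * g ^ m) * g = (g ^ (m + 1))⁻¹ * u * g ^ (m + 1) by
        rw [pow_succ]; group] at this
  have hinv : ∀ u ∈ H, g * u * g⁻¹ ∈ H := fun u hu => by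
    have := hpow (n - 1) _ (H.mul_mem (H.mul_mem hg hu) (H.inv_mem hg))
    obtain ⟨m, rfl⟩ := Nat.exists_eq_add_of_lt hn
    rw [Nat.zero_add] at this
    rwa [show (g ^ (m + 1 - 1))⁻¹ * (g ^ (m + 1) * u * (g ^ (m + 1))⁻¹) * g ^ (m + 1 - 1)
      = g * u * g⁻¹ by rw [Nat.add_sub_cancel, pow_succ]; group] at this
  refine Subgroup.mem_normalizer_iff.mpr fun u => ⟨hinv u, fun hu => ?_⟩
  have := h _ hu
  rwa [show g⁻¹ * (g * u * g⁻¹) * g = u by group] at this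

/-- A subgroup is covered by a finite set of at most `N` elements. -/
def CoveredBy (H : Subgroup G) (N : ℕ) : Prop := ∃ s : Finset G, (H : Set G) ⊆ s ∧ s.card ≤ N

/-- Every element is `g^m v` with `0 ≤ m < n` and `v ∈ H`. A cover yields finiteness and the order
bound together. -/
theorem CoveredBy.sup_zpowers {H : Subgroup G} {N n : ℕ} (hH : CoveredBy H N) {g : G}
    (hn : 0 < n) (hg : g ^ n ∈ H) (h : ∀ u ∈ H, g⁻¹ * u * g ∈ H) :
    CoveredBy (Subgroup.zpowers g ⊔ H) (n * N) := by
  classical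
  obtain ⟨s, hs, hsN⟩ := hH
  refine ⟨(Finset.range n ×ˢ s).image fun q => g ^ q.1 * q.2, fun u hu => ?_, ?_⟩
  · have hle : Subgroup.zpowers g ≤ Subgroup.normalizer (H : Set G) :=
      Subgroup.zpowers_le.mpr (mem_normalizer_of_pow_mem hn hg h)
    rw [Subgroup.coe_mul_of_left_le_normalizer_right _ _ hle] at hu
    obtain ⟨_, ⟨z, rfl⟩, v, hv, rfl⟩ := hu
    have hn' : (n : ℤ) ≠ 0 := by exact_mod_cast hn.ne'
    obtain ⟨m, hm⟩ := Int.eq_ofNat_of_zero_le (Int.emod_nonneg z hn')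
    have hlt : m < n := by
      have := Int.emod_lt_of_pos z (by exact_mod_cast hn : (0 : ℤ) < n)
      omega
    have hz : g ^ z * v = g ^ m * ((g ^ n) ^ (z / n) * v) := by
      conv_lhs => rw [← Int.emod_add_mul_ediv z n, hm]
      rw [zpow_add, zpow_mul, mul_assoc]; simp
    simp only [Finset.coe_image, Set.mem_image, Finset.mem_coe, Finset.mem_product,
      Finset.mem_range]
    exact ⟨(m, (g ^ n) ^ (z / n) * v), ⟨hlt, hs (H.mul_mem (H.zpow_mem hg _) hv)⟩, hz.symm⟩
  · refine Finset.card_image_le.trans ?_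
    rw [Finset.card_product, Finset.card_range]
    exact Nat.mul_le_mul_left n hsN

theorem CoveredBy.mono {H K : Subgroup G} {N : ℕ} (hK : CoveredBy K N) (h : H ≤ K) :
    CoveredBy H N := by
  obtain ⟨s, hs, hN⟩ := hK
  exact ⟨s, fun u hu => hs (h hu), hN⟩

theorem CoveredBy.closure_union {S : Set G} {N p : ℕ} (hS : CoveredBy (Subgroup.closure S) N)
    (hp : 0 < p) (g : ℕ → G) (n : ℕ) (hg : ∀ j < n, g j ^ p ∈ Subgroup.closure S)
    (h : ∀ j < n, ∀ u ∈ S ∪ g '' Set.Iio j,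
      (g j)⁻¹ * u * g j ∈ Subgroup.closure (S ∪ g '' Set.Iio j)) :
    CoveredBy (Subgroup.closure (S ∪ g '' Set.Iio n)) (p ^ n * N) := by
  induction n with
  | zero => simpa using hS
  | succ n ih =>
    have h1 := (ih (fun j hj => hg j (by omega)) (fun j hj => h j (by omega))).sup_zpowers
      hp (Subgroup.closure_mono Set.subset_union_left (hg n n.lt_succ_self))
      (fun u hu => conj_mem_closure (h n n.lt_succ_self) hu)
    rw [← mul_assoc, ← pow_succ'] at h1
    refine h1.mono ((Subgroup.closure_le _).mpr ?_)
    rintro u (hu | ⟨j, hj, rfl⟩)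
    · exact Subgroup.mem_sup_right (Subgroup.subset_closure (Or.inl hu))
    · rcases Nat.lt_succ_iff_lt_or_eq.mp hj with hj | rfl
      · exact Subgroup.mem_sup_right (Subgroup.subset_closure (Or.inr ⟨j, hj, rfl⟩))
      · exact Subgroup.mem_sup_left (Subgroup.mem_zpowers _)

theorem commute_of_closure_eq_top {x y z : G} (htop : Subgroup.closure {x, y} = ⊤)
    (hx : gcomm z x = 1) (hy : gcomm z y = 1) (g : G) : Commute z g := by
  have : Subgroup.closure {x, y} ≤ Subgroup.centralizer {z} := by
    rw [Subgroup.closure_le]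
    rintro u (rfl | rfl)
    · exact Subgroup.mem_centralizer_singleton_iff.mpr (gcomm_eq_one_iff.mp hx).symm
    · exact Subgroup.mem_centralizer_singleton_iff.mpr (gcomm_eq_one_iff.mp hy).symm
  rw [htop] at this
  exact (Subgroup.mem_centralizer_singleton_iff.mp (this (Subgroup.mem_top g))).symm

/-- An upper bound for the order of a group in which the defining relations of `Gk` hold. -/
theorem coveredBy_top_of_relations {p k : ℕ} (hp : 0 < p) (hodd : Odd p) {x y : G}
    (htop : Subgroup.closure {x, y} = ⊤) (hx : x ^ p ^ (k + 1) = 1) (hy : y ^ p ^ 2 = 1)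
    (hxy : gcomm (x ^ p ^ k) y = 1) (hyx : gcomm (y ^ p) x = 1)
    (hz : ∀ i, 1 ≤ i → i ≤ (p ^ k - 1) / 2 →
      gcomm y ((x ^ i)⁻¹ * y * x ^ i) ^ p = 1 ∧
      gcomm (gcomm y ((x ^ i)⁻¹ * y * x ^ i)) x = 1 ∧
      gcomm (gcomm y ((x ^ i)⁻¹ * y * x ^ i)) y = 1) :
    CoveredBy (⊤ : Subgroup G)
      (p ^ (k + 1) * (p ^ p ^ k * (p * p ^ ((p ^ k - 1) / 2)))) := by
  set q := p ^ k with hq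
  have hq0 : 0 < q := pow_pos hp k
  have hqodd : q % 2 = 1 := Nat.odd_iff.mp hodd.pow
  obtain ⟨Y, hY⟩ : ∃ Y : ℕ → G, ∀ i, Y i = (x ^ i)⁻¹ * y * x ^ i := ⟨_, fun _ => rfl⟩
  obtain ⟨W, hW⟩ : ∃ W : ℕ → G, ∀ i, W i = gcomm y (Y (i + 1)) := ⟨_, fun _ => rfl⟩
  have hY0 : Y 0 = y := by rw [hY]; simp
  have hYadd : ∀ i j, (x ^ j)⁻¹ * Y i * x ^ j = Y (i + j) := fun i j => by
    rw [hY, hY, pow_add]; group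
  have hYq : Y q = y := by
    rw [hY, mul_assoc, ← gcomm_eq_one_iff.mp hxy]; group
  have hWc : ∀ i < (q - 1) / 2, ∀ g, Commute (W i) g := fun i hi g => by
    have := hz (i + 1) (by omega) (by omega)
    rw [← hY, ← hW] at this
    exact commute_of_closure_eq_top htop this.2.1 this.2.2 g
  have hyc : ∀ g, Commute (y ^ p) g := fun g =>
    commute_of_closure_eq_top htop hyx (gcomm_eq_one_iff.mpr (by rw [← pow_succ, ← pow_succ'])) g
  have hconj : ∀ z g : G, Commute z g → g⁻¹ * z * g = z := fun z g h => by
    rw [mul_assoc, h.eq]; group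
  have c1 : CoveredBy (Subgroup.closure (∅ ∪ W '' Set.Iio ((q - 1) / 2)))
      (p ^ ((q - 1) / 2) * 1) := by
    refine CoveredBy.closure_union (S := ∅) ⟨{1}, by simp, by simp⟩ hp W _ (fun j hj => ?_)
      fun j hj u hu => ?_
    · have := hz (j + 1) (by omega) (by omega)
      rw [← hY, ← hW] at this
      rw [this.1]; exact one_mem _
    · rw [mul_assoc, ← (hWc j hj u).eq, inv_mul_cancel_left]
      exact Subgroup.subset_closure hu
  rw [Set.empty_union, mul_one] at c1
  have c2 : CoveredBy (Subgroup.closure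
      (W '' Set.Iio ((q - 1) / 2) ∪ (fun _ => y ^ p) '' Set.Iio 1))
      (p ^ 1 * p ^ ((q - 1) / 2)) := by
    refine c1.closure_union hp _ 1 (fun j hj => ?_) fun j hj u hu => ?_
    · rw [← pow_mul, ← sq, hy]; exact one_mem _
    · rw [mul_assoc, ← (hyc u).eq, inv_mul_cancel_left]
      exact Subgroup.subset_closure hu
  obtain ⟨S, hS⟩ : ∃ S, S = W '' Set.Iio ((q - 1) / 2) ∪ (fun _ : ℕ => y ^ p) '' Set.Iio 1 :=
    ⟨_, rfl⟩
  rw [← hS, pow_one] at c2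
  have hSc : ∀ u ∈ S, ∀ g, Commute u g := by
    rw [hS]
    rintro _ (⟨i, hi, rfl⟩ | ⟨i, hi, rfl⟩) g
    · exact hWc i hi g
    · exact hyc g
  have hyS : y ^ p ∈ Subgroup.closure S :=
    Subgroup.subset_closure (hS ▸ Or.inr ⟨0, by simp, rfl⟩)
  have hWS : ∀ i < (q - 1) / 2, W i ∈ Subgroup.closure S := fun i hi =>
    Subgroup.subset_closure (hS ▸ Or.inl ⟨i, hi, rfl⟩)
  -- The relations cover only half of the distances. As `Y q = y`, conjugating the central `[y, Y (q
  -- - d)]` by `x^d` turns it into `[Y d, y]`, the inverse of `[y, Y d]`.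
  have hd : ∀ d, 1 ≤ d → d < q → gcomm y (Y d) ∈ Subgroup.closure S ∧
      ∀ g, Commute (gcomm y (Y d)) g := fun d hd1 hdq => by
    rcases le_or_gt d ((q - 1) / 2) with h | h
    · have h1 : gcomm y (Y d) = W (d - 1) := by rw [hW, Nat.sub_add_cancel hd1]
      rw [h1]
      exact ⟨hWS _ (by omega), hWc _ (by omega)⟩
    · have h1 : gcomm y (Y d) = (W (q - d - 1))⁻¹ := by
        have hlt : q - d - 1 < (q - 1) / 2 := by omega
        rw [← hconj _ (x ^ d) (hWc _ hlt _), hW, Nat.sub_add_cancel (by omega), conj_gcomm,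
          hYadd, Nat.sub_add_cancel hdq.le, hYq, ← hY, inv_gcomm]
      rw [h1]
      exact ⟨inv_mem (hWS _ (by omega)), fun g => (hWc _ (by omega) g).inv_left⟩
  have hcomm : ∀ i j, i < j → j < q → gcomm (Y i) (Y j) ∈ Subgroup.closure S :=
    fun i j hij hj => by
      obtain ⟨h1, h2⟩ := hd (j - i) (by omega) (by omega)
      have h3 := hconj _ (x ^ i) (h2 (x ^ i))
      rw [conj_gcomm, ← hY, hYadd, Nat.sub_add_cancel hij.le] at h3
      rwa [h3]
  -- Modulo the central subgroup generated by `S`, the `q` conjugates of `y` commute and have `p`-th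
  -- power one.
  have c3 := c2.closure_union hp Y q (fun j hj => by
      have h1 : Y j ^ p = (x ^ j)⁻¹ * y ^ p * x ^ j := by
        have := conj_pow (i := p) (a := (x ^ j)⁻¹) (b := y)
        rw [hY]; simpa using this
      rw [h1, hconj _ _ (hyc _)]; exact hyS) (fun j hj u hu => by
      rcases hu with hu | ⟨i, hi, rfl⟩
      · rw [hconj _ _ (hSc u hu _)]
        exact Subgroup.subset_closure (Or.inl hu)
      · have h1 : (Y j)⁻¹ * Y i * Y j = Y i * gcomm (Y i) (Y j) := by rw [gcomm]; group
        rw [h1]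
        exact mul_mem (Subgroup.subset_closure (Or.inr ⟨i, hi, rfl⟩))
          (Subgroup.closure_mono Set.subset_union_left (hcomm i j hi hj)))
  have c4 := c3.sup_zpowers (g := x) (n := p ^ (k + 1)) (pow_pos hp _) (hx ▸ one_mem _)
    (fun u hu => conj_mem_closure (fun u hu => by
      rcases hu with hu | ⟨i, hi, rfl⟩
      · rw [hconj _ _ (hSc u hu _)]
        exact Subgroup.subset_closure (Or.inl hu)
      · have h1 := hYadd i 1
        rw [pow_one] at h1
        rw [h1]
        rcases Nat.lt_or_ge (i + 1) q with h | h
        · exact Subgroup.subset_closure (Or.inr ⟨i + 1, h, rfl⟩)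
        · have hi' : i < q := hi
          rw [show i + 1 = q by omega, hYq, ← hY0]
          exact Subgroup.subset_closure (Or.inr ⟨0, hq0, rfl⟩)) hu)
  refine c4.mono ?_
  rw [← htop, Subgroup.closure_le]
  rintro u (rfl | rfl)
  · exact Subgroup.mem_sup_left (Subgroup.mem_zpowers _)
  · refine Subgroup.mem_sup_right (Subgroup.subset_closure (Or.inr ⟨0, hq0, hY0⟩))

theorem CoveredBy.finite_and_card_le {N : ℕ} (h : CoveredBy (⊤ : Subgroup G) N) :
    Finite G ∧ Nat.card G ≤ N := by
  obtain ⟨s, hs, hN⟩ := h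
  have hfin : (Set.univ : Set G).Finite := s.finite_toSet.subset hs
  refine ⟨Set.finite_univ_iff.mp hfin, ?_⟩
  rw [← Set.ncard_univ]
  exact (Set.ncard_le_ncard hs s.finite_toSet).trans (by rwa [Set.ncard_coe_finset])

end Cover

/-! ### The isomorphism between the presented group and the model -/

namespace GkModel

theorem closure_x_y (p k : ℕ) : Subgroup.closure {Gk.x p k, Gk.y p k} = ⊤ := by
  rw [← PresentedGroup.closure_range_of (GkRels p k)]
  congr 1
  ext g
  simp only [Set.mem_insert_iff, Set.mem_singleton_iff, Set.mem_range, Fin.exists_fin_two,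
    Gk.x, Gk.y, eq_comm]

section

variable {p k : ℕ} [hp : Fact p.Prime]

namespace Model

/-- Such elements are central; this settles every relator that asserts centrality. -/
theorem gcomm_eq_one_of_act_eq_one {g : Model p k} (ha : act p k g.a = 1) (hf : g.f = 0)
    (h : Model p k) : gcomm g h = 1 := by
  ext
  · exact gcomm_a _ _
  · exact gcomm_b _ _
  · rw [gcomm_f, ha, hf, one_f]; ring
  · rw [gcomm_c, ha, hf, one_c]
    simp [form, mul_comm]

theorem conj_gy_coords (i : ℕ) : ((gx ^ i)⁻¹ * gy * gx ^ i : Model p k).a = 0 ∧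
    ((gx ^ i)⁻¹ * gy * gx ^ i : Model p k).f = tee p k ^ i := by
  obtain ⟨h1, h2, h3, h4⟩ := gx_pow (p := p) (k := k) i
  constructor
  · simp [mul_a, h1]
  · rw [mul_assoc, inv_mul_f (by simp), mul_f, h1, h3, act_natCast]; simp

theorem relators_eq_one {r : FreeGroup (Fin 2)} (hr : r ∈ GkRels p k) :
    FreeGroup.lift ![(gx : Model p k), gy] r = 1 := by
  have hX : FreeGroup.lift ![(gx : Model p k), gy] freeX = gx := by simp [freeX]
  have hY : FreeGroup.lift ![(gx : Model p k), gy] freeY = gy := by simp [freeY]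
  have hYi : ∀ i, FreeGroup.lift ![(gx : Model p k), gy] (freeYi i)
      = (gx ^ i)⁻¹ * gy * gx ^ i := fun i => by
    rw [freeYi, map_mul, map_mul, map_inv, map_pow, hX, hY]
  have hcast : ((p ^ 2 : ℕ) : Trunc p k) = 0 := by
    rw [Nat.cast_pow, CharP.cast_eq_zero, zero_pow two_ne_zero]
  rcases hr with (rfl | rfl | rfl | rfl) | ⟨i, hi, hi', h⟩
  · obtain ⟨h1, h2, h3, h4⟩ := gx_pow (p := p) (k := k) (p ^ (k + 1))
    rw [map_pow, hX]
    ext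
    · rw [h1, ZMod.natCast_self, one_a]
    · rw [h2, one_b]
    · rw [h3, one_f]
    · rw [h4, one_c]
  · obtain ⟨h1, h2, h3, h4⟩ := gy_pow (p := p) (k := k) (p ^ 2)
    rw [map_pow, hY]
    ext
    · rw [h1, one_a]
    · rw [h2, ZMod.natCast_self, one_b]
    · rw [h3, hcast, one_f]
    · rw [h4, one_c]
  · rw [map_gcomm, map_pow, hX]
    refine gcomm_eq_one_of_act_eq_one ?_ (gx_pow _).2.2.1 _
    rw [(gx_pow _).1, act_natCast, tee_pow_top]
  · rw [map_gcomm, map_pow, hY]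
    refine gcomm_eq_one_of_act_eq_one ?_ ?_ _
    · rw [(gy_pow _).1, act_zero]
    · rw [(gy_pow _).2.2.1, CharP.cast_eq_zero]
  · obtain ⟨h1, h2⟩ := conj_gy_coords (p := p) (k := k) 0
    obtain ⟨h3, h4⟩ := conj_gy_coords (p := p) (k := k) i
    have hf : (gcomm ((gx ^ 0)⁻¹ * gy * gx ^ 0) ((gx ^ i)⁻¹ * gy * gx ^ i) : Model p k).f = 0 := by
      rw [gcomm_f, h1, h3, act_zero]; ring
    have ha := gcomm_a ((gx ^ 0)⁻¹ * gy * gx ^ 0) ((gx ^ i)⁻¹ * gy * gx ^ i : Model p k)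
    rcases h with rfl | rfl | rfl
    · rw [map_pow, map_gcomm, hYi, hYi]
      ext
      · rw [pow_a, ha]; simp
      · rw [pow_b, gcomm_b]; simp
      · rw [pow_f, hf]; simp
      · rw [pow_c_of_f_eq_zero hf, CharP.cast_eq_zero, zero_mul, one_c]
    · rw [map_gcomm, map_gcomm, hYi, hYi]
      exact gcomm_eq_one_of_act_eq_one (by rw [ha, act_zero]) hf _
    · rw [map_gcomm, map_gcomm, hYi, hYi]
      exact gcomm_eq_one_of_act_eq_one (by rw [ha, act_zero]) hf _

theorem closure_gx_gy (hp2 : p ≠ 2) : Subgroup.closure {(gx : Model p k), gy} = ⊤ := by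
  have hx : (gx : Model p k) ∈ Subgroup.closure {(gx : Model p k), gy} :=
    Subgroup.subset_closure (by simp)
  have hy : (gy : Model p k) ∈ Subgroup.closure {(gx : Model p k), gy} :=
    Subgroup.subset_closure (by simp)
  have hgc : ∀ a ∈ Subgroup.closure {(gx : Model p k), gy},
      ∀ b ∈ Subgroup.closure {(gx : Model p k), gy},
      gcomm a b ∈ Subgroup.closure {(gx : Model p k), gy} := fun a ha b hb =>
    mul_mem (mul_mem (mul_mem (inv_mem ha) (inv_mem hb)) ha) hb
  have hc : ∀ m, leftComm gy gx m ∈ Subgroup.closure {(gx : Model p k), gy} := fun m => by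
    induction m with
    | zero => exact hy
    | succ m ih => exact hgc _ ih _ hx
  have hq : 0 < p ^ k := pow_pos hp.out.pos k
  rw [← top_le_iff, ← frattiniSeries.eq_1 p (Model p k), frattiniSeries_eq hp2]
  refine layer_le (by simpa using hx) (by simpa using hy) fun g hg ha hb => ?_
  -- Both upper bounds lie beyond the truncation, so the approximation ends at the identity.
  refine mem_of_forall_mem hp2 (r₀ := 1) (r₁ := p ^ k) (s₀ := 0) (s₁ := p ^ k) le_rfl hq
    (Nat.zero_le _) le_rfl (fun m _ _ => hc m) (fun m _ _ _ => hgc _ (hc m) _ hy) ?_ g ha hb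
    (by rw [pow_one]; exact xi_dvd_f_of_b_eq_zero hb) (by simp)
  intro g ha hb hf hc
  rw [xi_pow_eq_zero p k (by omega), zero_dvd_iff] at hf hc
  rw [show g = 1 by ext <;> assumption]
  exact one_mem _

end Model

open Model

theorem coveredBy_Gk {p : ℕ} (k : ℕ) (hp : 0 < p) (hodd : Odd p) :
    CoveredBy (⊤ : Subgroup (Gk p k))
      (p ^ (k + 1) * (p ^ p ^ k * (p * p ^ ((p ^ k - 1) / 2)))) := by
  have hrel : ∀ r ∈ GkRels p k, PresentedGroup.mk (GkRels p k) r = 1 := fun r hr =>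
    PresentedGroup.one_of_mem hr
  have hX : PresentedGroup.mk (GkRels p k) freeX = Gk.x p k := rfl
  have hY : PresentedGroup.mk (GkRels p k) freeY = Gk.y p k := rfl
  have hYi : ∀ i, PresentedGroup.mk (GkRels p k) (freeYi i)
      = (Gk.x p k ^ i)⁻¹ * Gk.y p k * Gk.x p k ^ i := fun i => by
    rw [freeYi, map_mul, map_mul, map_inv, map_pow, hX, hY]
  have hY0 : PresentedGroup.mk (GkRels p k) (freeYi 0) = Gk.y p k := by rw [hYi]; simp
  refine coveredBy_top_of_relations hp hodd (closure_x_y p k) ?_ ?_ ?_ ?_ fun i hi hi' => ⟨?_, ?_, ?_⟩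
  · rw [← hX, ← map_pow]; exact hrel _ (by simp [GkRels])
  · rw [← hY, ← map_pow]; exact hrel _ (by simp [GkRels])
  · rw [← hX, ← hY, ← map_pow, ← map_gcomm]; exact hrel _ (by simp [GkRels])
  · rw [← hX, ← hY, ← map_pow, ← map_gcomm]; exact hrel _ (by simp [GkRels])
  · rw [← hYi, ← hY0, ← map_gcomm, ← map_pow]
    exact hrel _ (Or.inr ⟨i, hi, hi', Or.inl rfl⟩)
  · rw [← hYi, ← hY0, ← hX, ← map_gcomm, ← map_gcomm]
    exact hrel _ (Or.inr ⟨i, hi, hi', Or.inr (Or.inl rfl)⟩)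
  · have h := hrel _ (Or.inr ⟨i, hi, hi', Or.inr (Or.inr rfl)⟩)
    rwa [map_gcomm, map_gcomm, hY0, hYi, hY] at h

/-- The presented group maps onto the model and has at most as many elements. -/
theorem exists_mulEquiv (hp2 : p ≠ 2) :
    ∃ e : Gk p k ≃* Model p k, e (Gk.x p k) = gx ∧ e (Gk.y p k) = gy := by
  let φ : Gk p k →* Model p k := PresentedGroup.toGroup (f := ![gx, gy])
    fun r hr => relators_eq_one hr
  have hφx : φ (Gk.x p k) = gx := PresentedGroup.toGroup.of _
  have hφy : φ (Gk.y p k) = gy := PresentedGroup.toGroup.of _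
  have hsurj : Function.Surjective φ := by
    rw [← MonoidHom.range_eq_top, ← top_le_iff, ← closure_gx_gy hp2, Subgroup.closure_le]
    rintro u (rfl | rfl)
    · exact ⟨_, hφx⟩
    · exact ⟨_, hφy⟩
  obtain ⟨hfin, hcard⟩ := (coveredBy_Gk k hp.out.pos (hp.out.odd_of_ne_two hp2)).finite_and_card_le
  have hcardM : Nat.card (Model p k) = p ^ (k + 1) * (p ^ p ^ k * (p * p ^ ((p ^ k - 1) / 2))) := by
    have h1 := card_layer (p := p) (k := k) hp2 (Nat.zero_le _)
    rw [← frattiniSeries_eq hp2, frattiniSeries, Subgroup.card_top] at h1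
    rw [h1, ← pow_succ', ← pow_add, ← pow_add, mu_zero]
    have hq : 0 < p ^ k := pow_pos hp.out.pos k
    congr 1
    omega
  have hfinM : Finite (Model p k) := Finite.of_surjective φ hsurj
  have hle : Nat.card (Gk p k) = Nat.card (Model p k) :=
    le_antisymm (hcard.trans hcardM.ge) (Nat.card_le_card_of_surjective φ hsurj)
  have hbij : Function.Bijective φ := (Nat.bijective_iff_surjective_and_card φ).mpr ⟨hsurj, hle⟩
  exact ⟨MulEquiv.ofBijective φ hbij, hφx, hφy⟩

end
end GkModel

/-! ### Frattini series in general: isomorphisms, elementary abelian factors, length -/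

section General

open scoped commutatorElement

variable {G : Type*} [Group G]

theorem map_powSubgroup {H : Type*} [Group H] (p : ℕ) (φ : G →* H) (K : Subgroup G) :
    (powSubgroup p K).map φ = powSubgroup p (K.map φ) := by
  rw [powSubgroup, powSubgroup, MonoidHom.map_closure]
  congr 1
  ext u
  constructor
  · rintro ⟨_, ⟨g, hg, rfl⟩, rfl⟩
    exact ⟨φ g, ⟨g, hg, rfl⟩, (map_pow φ g p).symm⟩
  · rintro ⟨_, ⟨g, hg, rfl⟩, rfl⟩
    exact ⟨g ^ p, ⟨g, hg, rfl⟩, map_pow φ g p⟩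

theorem map_frattiniSeries {H : Type*} [Group H] (p : ℕ) (e : G ≃* H) (i : ℕ) :
    (frattiniSeries p G i).map e.toMonoidHom = frattiniSeries p H i := by
  induction i with
  | zero => exact Subgroup.map_top_of_surjective _ e.surjective
  | succ i ih =>
    rw [frattiniSeries, frattiniSeries, Subgroup.map_sup, map_powSubgroup,
      Subgroup.map_commutator, ih]

theorem nonempty_linearEquiv_of_card {A : Type*} [AddCommGroup A] {p n : ℕ} (hp : p.Prime)
    [Module (ZMod p) A] (hcard : Nat.card A = p ^ n) :
    Nonempty (A ≃ₗ[ZMod p] (Fin n → ZMod p)) := by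
  have : Fact p.Prime := ⟨hp⟩
  have hfin : Finite A := Nat.finite_of_card_ne_zero (hcard ▸ (pow_pos hp.pos n).ne')
  have h1 := Module.natCard_eq_pow_finrank (K := ZMod p) (V := A)
  rw [hcard, Nat.card_zmod] at h1
  exact ⟨LinearEquiv.ofFinrankEq _ _ (by
    rw [Module.finrank_fin_fun, Nat.pow_right_injective hp.two_le h1])⟩

theorem isElemAbelianOfRank_of_card {p n : ℕ} (hp : p.Prime) (hcomm : ∀ a b : G, a * b = b * a)
    (hpow : ∀ a : G, a ^ p = 1) (hcard : Nat.card G = p ^ n) : IsElemAbelianOfRank p G n := by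
  refine ⟨n, rfl, ?_⟩
  have : Fact p.Prime := ⟨hp⟩
  let _ : CommGroup G := { (inferInstance : Group G) with mul_comm := hcomm }
  let _ : Module (ZMod p) (Additive G) := AddCommGroup.zmodModule fun a => hpow a.toMul
  have hcard' : Nat.card (Additive G) = p ^ n := hcard
  obtain ⟨e⟩ := nonempty_linearEquiv_of_card hp hcard'
  exact ⟨MulEquiv.toAdditiveLeft.symm e.toAddEquiv⟩

theorem pow_mem_frattiniSeries_succ {p i : ℕ} {g : G} (hg : g ∈ frattiniSeries p G i) :
    g ^ p ∈ frattiniSeries p G (i + 1) :=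
  (le_sup_left : powSubgroup p (frattiniSeries p G i) ≤ _) (Subgroup.subset_closure ⟨g, hg, rfl⟩)

theorem commutator_mem_frattiniSeries_succ {p i : ℕ} {g h : G} (hg : g ∈ frattiniSeries p G i)
    (hh : h ∈ frattiniSeries p G i) : ⁅g, h⁆ ∈ frattiniSeries p G (i + 1) :=
  (le_sup_right : ⁅frattiniSeries p G i, frattiniSeries p G i⁆ ≤ _)
    (Subgroup.commutator_mem_commutator hg hh)

theorem isElemAbelianOfRank_frattiniFactor {p i n m : ℕ} (hp : p.Prime)
    (hle : frattiniSeries p G (i + 1) ≤ frattiniSeries p G i)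
    (h1 : Nat.card (frattiniSeries p G i) = p ^ (n + m))
    (h2 : Nat.card (frattiniSeries p G (i + 1)) = p ^ m) :
    IsElemAbelianOfRank p (FrattiniFactor p G i) n := by
  refine isElemAbelianOfRank_of_card hp ?_ ?_ ?_
  · intro a b
    induction a using QuotientGroup.induction_on with | H a => ?_
    induction b using QuotientGroup.induction_on with | H b => ?_
    rw [← QuotientGroup.mk_mul, ← QuotientGroup.mk_mul, QuotientGroup.eq,
      Subgroup.mem_subgroupOf]
    have := commutator_mem_frattiniSeries_succ (inv_mem b.2) (inv_mem a.2)
    simpa [commutatorElement_def, mul_assoc] using this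
  · intro a
    induction a using QuotientGroup.induction_on with | H a => ?_
    rw [← QuotientGroup.mk_pow, QuotientGroup.eq_one_iff, Subgroup.mem_subgroupOf]
    exact pow_mem_frattiniSeries_succ a.2
  · have h3 := Subgroup.card_eq_card_quotient_mul_card_subgroup
      ((frattiniSeries p G (i + 1)).subgroupOf (frattiniSeries p G i))
    rw [h1, Nat.card_congr (Subgroup.subgroupOfEquivOfLe hle).toEquiv, h2, pow_add] at h3
    exact (Nat.eq_of_mul_eq_mul_right (pow_pos hp.pos m) h3).symm

theorem isElemAbelianOfRank_frattiniSeries {p i n : ℕ} (hp : p.Prime)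
    (hbot : frattiniSeries p G (i + 1) = ⊥)
    (h1 : Nat.card (frattiniSeries p G i) = p ^ n) :
    IsElemAbelianOfRank p (frattiniSeries p G i) n := by
  refine isElemAbelianOfRank_of_card hp (fun a b => ?_) (fun a => ?_) h1
  · have := commutator_mem_frattiniSeries_succ a.2 b.2
    rw [hbot, Subgroup.mem_bot, commutatorElement_eq_one_iff_mul_comm] at this
    exact Subtype.ext this
  · have := pow_mem_frattiniSeries_succ a.2
    rw [hbot, Subgroup.mem_bot] at this
    exact Subtype.ext this

theorem frattiniLength_succ {p l : ℕ} (hanti : Antitone (frattiniSeries p G))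
    (h : frattiniSeries p G (l + 1) = ⊥) (h' : frattiniSeries p G l ≠ ⊥) :
    FrattiniLength p G (l + 1) := by
  refine ⟨h, fun n hn => ?_⟩
  by_contra hlt
  exact h' (le_bot_iff.mp ((hanti (by omega)).trans_eq hn))

end General

/-! ### Arithmetic of `mu`, `nuFun` and the ranks -/

namespace GkModel

theorem pred_mul_mu {p : ℕ} (hp : 1 ≤ p) (i : ℕ) : (p - 1) * mu p i + 1 = p ^ i := by
  obtain ⟨r, rfl⟩ := Nat.exists_eq_add_of_le' hp
  rw [Nat.add_sub_cancel]
  induction i with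
  | zero => simp [mu_zero]
  | succ i ih => rw [mu_succ, pow_succ]; linear_combination ih

theorem cast_mu {p : ℕ} (hp : 2 ≤ p) (i : ℕ) : (mu p i : ℚ) = ((p : ℚ) ^ i - 1) / ((p : ℚ) - 1) := by
  have h1 : (p : ℚ) ≠ 1 := by exact_mod_cast (by omega : p ≠ 1)
  rw [mu, ← geom_sum_eq h1]; push_cast; rfl

theorem nuFun_eq {p : ℕ} (hp : 2 ≤ p) (k j : ℕ) : nuFun p k j = min (mu p j) (p ^ k) := by
  rw [nuFun, mu, Nat.geomSum_eq hp]

theorem nuFun_eq_mu {p k j : ℕ} (hp : 3 ≤ p) (hj : j ≤ k) : nuFun p k j = mu p j := by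
  rw [nuFun_eq (by omega)]
  have h1 := two_mul_mu_lt hp j
  have h2 : p ^ j ≤ p ^ k := Nat.pow_le_pow_right (by omega) hj
  exact min_eq_left (by omega)

theorem nuFun_succ_self {p : ℕ} (hp : 2 ≤ p) (k : ℕ) : nuFun p k (k + 1) = p ^ k := by
  rw [nuFun_eq hp, mu_succ]
  exact min_eq_right (Nat.le_add_left _ _)

/-- The logarithm of the order of the `i`-th layer. -/
def layerRank (p k i : ℕ) : ℕ :=
  (k + 1 - i) + (2 - i) + (p ^ k - max 1 (mu p i)) + ((p ^ k - 1) / 2 - mu p (i - 1))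

theorem layerRank_succ_self {p k : ℕ} (hk : 1 ≤ k) :
    layerRank p k (k + 1) = (p ^ k - 1) / 2 - mu p k := by
  have h3 := mu_succ p k
  simp only [layerRank, Nat.add_sub_cancel]
  omega

section Ranks

variable {p k : ℕ} 
theorem layerRank_zero (hp : 3 ≤ p) (hk : 1 ≤ k) : layerRank p k 0 = 2 + layerRank p k 1 := by
  have h1 : p ^ 1 ≤ p ^ k := Nat.pow_le_pow_right (by omega) hk
  simp only [layerRank, mu_zero, mu_one, Nat.sub_self, Nat.zero_sub]
  omega

theorem layerRank_one_of_eq_one (hp : 3 ≤ p) : layerRank p 1 1 = p + 2 + layerRank p 1 2 := by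
  simp only [layerRank, mu_zero, mu_one, mu_two, Nat.sub_self, pow_one, Nat.add_one_sub_one]
  omega

theorem layerRank_one (hp : 3 ≤ p) (hk : 2 ≤ k) : layerRank p k 1 = p + 3 + layerRank p k 2 := by
  have h1 : p ^ 2 ≤ p ^ k := Nat.pow_le_pow_right (by omega) hk
  have h2 : 3 * p ≤ p ^ 2 := by rw [sq]; exact Nat.mul_le_mul_right p hp
  simp only [layerRank, mu_zero, mu_one, mu_two, Nat.sub_self, Nat.add_one_sub_one]
  omega

theorem layerRank_of_lt (hp : 3 ≤ p) {i : ℕ} (hi : 2 ≤ i) (hik : i < k) :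
    layerRank p k i = p ^ i + p ^ (i - 1) + 1 + layerRank p k (i + 1) := by
  have h1 : p ^ (i + 1) ≤ p ^ k := Nat.pow_le_pow_right (by omega) hik
  have h2 := two_mul_mu_lt hp (i + 1)
  have h3 := mu_succ p i
  have h4 := mu_succ p (i - 1)
  rw [Nat.sub_add_cancel (by omega)] at h4
  have h5 := one_le_mu (p := p) (by omega : 1 ≤ i)
  simp only [layerRank, Nat.add_sub_cancel]
  omega

/-- The truncation cuts in: `mu p (k + 1) ≥ p^k`, so `f` contributes `p^k - mu p k` instead of
`p^k`, next to `p^{k-1}` from `c` and `1` from `a`. -/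
theorem layerRank_self (hp : 3 ≤ p) (hk : 2 ≤ k) :
    layerRank p k k = (1 + p ^ k - mu p (k - 1)) + layerRank p k (k + 1) := by
  have h2 := two_mul_mu_lt hp k
  have h3 := mu_succ p k
  have h4 := mu_succ p (k - 1)
  rw [Nat.sub_add_cancel (by omega)] at h4
  have h5 := one_le_mu (p := p) (by omega : 1 ≤ k)
  simp only [layerRank, Nat.add_sub_cancel]
  omega

end Ranks

/-! ### Generators of each layer modulo the next, and the last layers -/

section

variable {p k : ℕ} [hp : Fact p.Prime]

namespace Model

theorem layer_antitone : Antitone fun i => layer p k i := by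
  intro i j hij g hg
  have h1 := mu_mono p hij
  have h2 := mu_mono p (Nat.sub_le_sub_right hij 1)
  exact ⟨(pow_dvd_pow _ hij).trans hg.1, (pow_dvd_pow _ hij).trans hg.2.1,
    (pow_dvd_pow _ h1).trans hg.2.2.1, (pow_dvd_pow _ (by omega)).trans hg.2.2.2⟩

theorem leftComm_mem_layer {i m : ℕ} (hi : 1 ≤ i) (hm : mu p i ≤ m) :
    leftComm gy gx m ∈ layer p k i := by
  obtain ⟨h1, h2, h3, h4⟩ := leftComm_coords (p := p) (k := k) m
  have h5 := mu_succ p (i - 1)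
  rw [Nat.sub_add_cancel hi] at h5
  have h6 : 0 < p ^ (i - 1) := pow_pos hp.out.pos _
  rw [mem_layer, h1, h2, h4 (by omega)]
  exact ⟨dvd_zero _, dvd_zero _, pow_dvd_pow _ hm, (pow_dvd_pow _ (by omega)).trans h3⟩

theorem gz_mem_layer {i m : ℕ} (hm : 2 * mu p (i - 1) ≤ m) : gz p k m ∈ layer p k i := by
  obtain ⟨h1, h2, h3, h4⟩ := gz_coords (p := p) (k := k) m
  rw [mem_layer, h1, h2, h3, h4]
  exact ⟨dvd_zero _, dvd_zero _, dvd_zero _,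
    (dvd_form_left (pow_dvd_pow _ hm) _).mul_left _⟩

theorem gx_pow_eq_one {i : ℕ} (hi : k + 1 ≤ i) : (gx : Model p k) ^ p ^ i = 1 := by
  obtain ⟨h1, h2, h3, h4⟩ := gx_pow (p := p) (k := k) (p ^ i)
  ext
  · rw [h1, (ZMod.natCast_eq_zero_iff _ _).mpr (pow_dvd_pow p hi), one_a]
  · rw [h2, one_b]
  · rw [h3, one_f]
  · rw [h4, one_c]

theorem gy_pow_eq_one {i : ℕ} (hi : 2 ≤ i) : (gy : Model p k) ^ p ^ i = 1 := by
  obtain ⟨h1, h2, h3, h4⟩ := gy_pow (p := p) (k := k) (p ^ i)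
  ext
  · rw [h1, one_a]
  · rw [h2, (ZMod.natCast_eq_zero_iff _ _).mpr (pow_dvd_pow p hi), one_b]
  · rw [h3, Nat.cast_pow, CharP.cast_eq_zero, zero_pow (by omega), one_f]
  · rw [h4, one_c]

theorem layer_le_of_forall_mem (hp2 : p ≠ 2) {K : Subgroup (Model p k)} {i r s : ℕ}
    (hi : 1 ≤ i) (hx : gx ^ p ^ i ∈ K) (hy : gy ^ p ^ i ∈ K)
    (hs : mu p (i - 1) ≤ s)
    (hc : ∀ m, mu p i ≤ m → m < r → leftComm gy gx m ∈ K)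
    (hz : ∀ m, Odd m → 2 * mu p (i - 1) + 1 ≤ m → m ≤ 2 * s - 1 → gz p k m ∈ K)
    (hK : ∀ g : Model p k, g.a = 0 → g.b = 0 → xi p k ^ r ∣ g.f → xi p k ^ (2 * s) ∣ g.c → g ∈ K) :
    layer p k i ≤ K := by
  refine layer_le hx hy fun g hg ha hb => ?_
  have h5 := mu_succ p (i - 1)
  rw [Nat.sub_add_cancel hi] at h5
  have h6 : 0 < p ^ (i - 1) := pow_pos hp.out.pos _
  -- In the last layer `r = p^k` may lie below `mu p i`; then no generators are needed for `f`.
  refine mem_of_forall_mem hp2 (r₀ := mu p i) (r₁ := max r (mu p i)) (one_le_mu hi)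
    (le_max_right _ _) hs (by omega) (fun m hm hm' => hc m hm (by omega)) hz ?_ g ha hb
    hg.2.2.1 hg.2.2.2
  intro g ha hb hf hgc
  refine hK g ha hb ((pow_dvd_pow _ (le_max_left _ _)).trans hf) hgc

theorem layer_eq_closure_sup (hp2 : p ≠ 2) {S : Set (Model p k)} {i r : ℕ} (hi : 1 ≤ i)
    (hS : S ⊆ layer p k i) (hx : gx ^ p ^ i ∈ S)
    (hy : gy ^ p ^ i ∈ Subgroup.closure S) (hr : min (mu p (i + 1)) (p ^ k) ≤ r)
    (hc : ∀ m, mu p i ≤ m → m < r → leftComm gy gx m ∈ S)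
    (hz : ∀ m, Odd m → 2 * mu p (i - 1) + 1 ≤ m → m ≤ 2 * mu p i - 1 → gz p k m ∈ S) :
    layer p k i = Subgroup.closure S ⊔ layer p k (i + 1) := by
  refine le_antisymm ?_ (sup_le ((Subgroup.closure_le _).mpr hS) (layer_antitone (Nat.le_succ i)))
  have hle : Subgroup.closure S ≤ Subgroup.closure S ⊔ layer p k (i + 1) := le_sup_left
  have hSK : S ⊆ (Subgroup.closure S ⊔ layer p k (i + 1) : Subgroup _) :=
    Subgroup.subset_closure.trans hle
  have hmono := mu_mono p (Nat.le_succ i)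
  refine layer_le_of_forall_mem hp2 (r := r) (s := mu p i) hi (hSK hx) (hle hy)
    (mu_mono p (Nat.sub_le i 1)) (fun m h h' => hSK (hc m h h'))
    (fun m h h' h'' => hSK (hz m h h' h'')) fun g ha hb hf hgc => ?_
  refine (le_sup_right : layer p k (i + 1) ≤ _) ⟨ha ▸ dvd_zero _, hb ▸ dvd_zero _, ?_, hgc⟩
  exact fil_le_of_min_le hr hf

theorem layer_succ_self_eq_closure (hp2 : p ≠ 2) (hk : 1 ≤ k) :
    layer p k (k + 1) = Subgroup.closure
      ((fun m => gz p k m) '' {m | Odd m ∧ 2 * mu p k + 1 ≤ m ∧ m ≤ p ^ k - 2}) := by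
  refine le_antisymm ?_ ((Subgroup.closure_le _).mpr ?_)
  · have hp3 : 3 ≤ p := by have := hp.out.two_le; omega
    have h1 := two_mul_mu_lt hp3 k
    have h2 : p ^ k % 2 = 1 := Nat.odd_iff.mp (hp.out.odd_of_ne_two hp2).pow
    refine layer_le_of_forall_mem hp2 (r := p ^ k) (s := (p ^ k - 1) / 2) (Nat.le_add_left 1 k)
      ?_ ?_ (by rw [Nat.add_sub_cancel]; omega) ?_ ?_ ?_
    · rw [gx_pow_eq_one le_rfl]; exact one_mem _
    · rw [gy_pow_eq_one (by omega)]; exact one_mem _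
    · intro m hm hm'
      rw [mu_succ] at hm; omega
    · intro m hm hm' hm''
      rw [Nat.add_sub_cancel] at hm'
      exact Subgroup.subset_closure ⟨m, ⟨hm, hm', by omega⟩, rfl⟩
    · intro g ha hb hf hc
      -- Here `2s = p^k - 1` is even, so antisymmetry raises the valuation to `p^k` and `c`
      -- vanishes.
      have hc' := dvd_of_antisymm hp2 (even_two_mul _) hc g.bar_c
      rw [xi_pow_eq_zero p k (by omega), zero_dvd_iff] at hf hc'
      rw [show g = 1 by ext <;> assumption]
      exact one_mem _
  · rintro _ ⟨m, ⟨-, hm, -⟩, rfl⟩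
    exact gz_mem_layer (by rw [Nat.add_sub_cancel]; omega)

theorem layer_add_two_eq_bot : layer p k (k + 2) = ⊥ := by
  refine (Subgroup.eq_bot_iff_forall _).mpr fun g hg => ?_
  obtain ⟨h1, h2, h3, h4⟩ := hg
  have h5 : p ^ k ≤ mu p (k + 1) := by rw [mu_succ]; omega
  have h6 : mu p (k + 1) ≤ mu p (k + 2) := mu_mono p (Nat.le_succ _)
  rw [← Nat.cast_pow, (ZMod.natCast_eq_zero_iff _ _).mpr (pow_dvd_pow p (by omega)),
    zero_dvd_iff] at h1 h2
  rw [xi_pow_eq_zero p k (by omega), zero_dvd_iff] at h3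
  rw [xi_pow_eq_zero p k (by rw [show k + 2 - 1 = k + 1 from rfl]; omega), zero_dvd_iff] at h4
  ext <;> assumption

end Model

end
end GkModel

/-! ### Transfer of the results from the model to the presented group -/

open GkModel Model in
theorem proposition6p5 (p k : ℕ) (hp : p.Prime) (hp2 : p ≠ 2) (hk : 1 ≤ k) :
    -- the length of the series
    FrattiniLength p (Gk p k) (if p = 3 then k + 1 else k + 2) ∧
    -- the term with index `0`
    (frattiniSeries p (Gk p k) 0 = ⊤ ∧
      frattiniSeries p (Gk p k) 0 =
        Subgroup.closure {Gk.x p k, Gk.y p k} ⊔ frattiniSeries p (Gk p k) 1 ∧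
      IsElemAbelianOfRank p (FrattiniFactor p (Gk p k) 0) 2) ∧
    -- the term with index `1`
    (frattiniSeries p (Gk p k) 1 =
        Subgroup.closure ({Gk.x p k ^ p, Gk.y p k ^ p} ∪ Gk.c p k '' Set.Icc 1 p ∪ {Gk.z p k 1})
          ⊔ frattiniSeries p (Gk p k) 2 ∧
      IsElemAbelianOfRank p (FrattiniFactor p (Gk p k) 1)
        (if k = 1 then (p : ℚ) + 2 else (p : ℚ) + 3)) ∧
    -- the terms with index `2 ≤ i ≤ k`
    (∀ i : ℕ, 2 ≤ i → i ≤ k →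
      frattiniSeries p (Gk p k) i =
        Subgroup.closure ({Gk.x p k ^ p ^ i}
            ∪ Gk.c p k '' {m | nuFun p k i ≤ m ∧ m ≤ nuFun p k (i + 1) - 1}
            ∪ Gk.z p k '' {m | Odd m ∧ 2 * nuFun p k (i - 1) + 1 ≤ m ∧ m ≤ 2 * nuFun p k i - 1})
          ⊔ frattiniSeries p (Gk p k) (i + 1) ∧
      IsElemAbelianOfRank p (FrattiniFactor p (Gk p k) i)
        (if i ≠ k then (p : ℚ) ^ i + (p : ℚ) ^ (i - 1) + 1
         else (p : ℚ) ^ k + 1 - ((p : ℚ) ^ (k - 1) - 1) / ((p : ℚ) - 1))) ∧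
    -- the values of `ν`
    ((∀ j : ℕ, 1 ≤ j → j ≤ k → (nuFun p k j : ℚ) = ((p : ℚ) ^ j - 1) / ((p : ℚ) - 1)) ∧
      nuFun p k (k + 1) = p ^ k) ∧
    -- the term with index `k + 1`
    (frattiniSeries p (Gk p k) (k + 1) =
        Subgroup.closure (Gk.z p k '' {m | Odd m ∧ 2 * nuFun p k k + 1 ≤ m ∧ m ≤ p ^ k - 2}) ∧
      IsElemAbelianOfRank p (frattiniSeries p (Gk p k) (k + 1))
        (((p : ℚ) ^ (k + 1) - 3 * (p : ℚ) ^ k - (p : ℚ) + 3) / (2 * ((p : ℚ) - 1)))) := by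
  have : Fact p.Prime := ⟨hp⟩
  have hp3 : 3 ≤ p := by have := hp.two_le; omega
  obtain ⟨e, hx, hy⟩ := exists_mulEquiv (p := p) (k := k) hp2
  have hc : ∀ m, e (Gk.c p k m) = leftComm gy gx m := fun m => by
    rw [Gk.c, ← hx, ← hy]; exact map_leftComm e.toMonoidHom _ _ m
  have hz : ∀ m, e (Gk.z p k m) = gz p k m := fun m => by
    rw [Gk.z, gz, ← hc, ← hy]; exact map_gcomm e.toMonoidHom _ _
  have hΦ : ∀ i, (frattiniSeries p (Gk p k) i).map e.toMonoidHom = layer p k i := fun i => by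
    rw [map_frattiniSeries, frattiniSeries_eq hp2]
  have hinj : Function.Injective (Subgroup.map e.toMonoidHom) := Subgroup.map_injective e.injective
  have hcard : ∀ i ≤ k + 1, Nat.card (frattiniSeries p (Gk p k) i) = p ^ layerRank p k i :=
    fun i hi => by
      rw [layerRank, ← card_layer hp2 hi, ← hΦ]
      exact Nat.card_congr (Subgroup.equivMapOfInjective _ _ e.injective).toEquiv
  have hanti : Antitone (frattiniSeries p (Gk p k)) := fun i j hij =>
    (Subgroup.map_le_map_iff_of_injective (f := e.toMonoidHom) e.injective).mp (by
      rw [hΦ, hΦ]; exact layer_antitone hij)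
  have hbot : frattiniSeries p (Gk p k) (k + 2) = ⊥ := hinj (by
    rw [hΦ, layer_add_two_eq_bot, Subgroup.map_bot])
  have hfactor : ∀ i n, i ≤ k → layerRank p k i = n + layerRank p k (i + 1) →
      IsElemAbelianOfRank p (FrattiniFactor p (Gk p k) i) n := fun i n hi h =>
    isElemAbelianOfRank_frattiniFactor hp (hanti (Nat.le_succ i)) (h ▸ hcard i (by omega))
      (hcard (i + 1) (by omega))
  have hgen : ∀ i (S : Set (Gk p k)),
      layer p k i = Subgroup.closure (e '' S) ⊔ layer p k (i + 1) →
      frattiniSeries p (Gk p k) i = Subgroup.closure S ⊔ frattiniSeries p (Gk p k) (i + 1) :=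
    fun i S h => hinj (by
      rw [Subgroup.map_sup, hΦ, hΦ, h, MonoidHom.map_closure]; rfl)
  have hbot_iff : ∀ i ≤ k + 1, frattiniSeries p (Gk p k) i = ⊥ ↔ layerRank p k i = 0 :=
    fun i hi => by
      rw [← Subgroup.card_eq_one, hcard i hi, Nat.pow_eq_one]
      have := hp.one_lt
      constructor
      · rintro (h | h) <;> omega
      · exact Or.inr
  have hq : (p - 1) * mu p k + 1 = p ^ k := pred_mul_mu hp.one_le k
  have hmu1 : 1 ≤ mu p k := one_le_mu hk
  refine ⟨?_, ⟨rfl, ?_, ?_⟩, ⟨?_, ?_⟩, fun i hi hik => ⟨?_, ?_⟩, ⟨fun j hj hjk => ?_, ?_⟩, ?_, ?_⟩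
  · split_ifs with h3
    · subst h3
      refine frattiniLength_succ hanti ?_ ?_
      -- The rank is `(p^k - 1)/2 - mu p k = (p - 3)/2 * mu p k`, which is zero exactly for `p = 3`.
      · rw [hbot_iff _ le_rfl, layerRank_succ_self hk]
        omega
      -- The summand `k + 1 - k = 1`, which belongs to `x^{p^k}`, is already positive.
      · rw [Ne, hbot_iff _ (Nat.le_succ k), layerRank]
        omega
    · refine frattiniLength_succ hanti hbot ?_
      rw [Ne, hbot_iff _ le_rfl, layerRank_succ_self hk]
      have h5 : 4 ≤ p - 1 := by
        have : p ≠ 4 := by rintro rfl; exact absurd hp (by decide)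
        omega
      have := Nat.mul_le_mul_right (mu p k) h5
      omega
  · rw [closure_x_y, top_sup_eq]; rfl
  · exact_mod_cast hfactor 0 2 (Nat.zero_le k) (layerRank_zero hp3 hk)
  · refine hgen 1 _ ?_
    simp only [Set.image_union, Set.image_insert_eq, Set.image_singleton, Set.image_image, map_pow,
      hx, hy, hc, hz]
    -- The value `p + 1 = mu p 2` also serves `k = 1`, where `min (p + 1) p = p`; the generator with
    -- `p` entries `x` is then redundant.
    refine layer_eq_closure_sup hp2 (r := p + 1) le_rfl ?_ ?_ ?_ ?_ ?_ ?_
    · rintro u (((rfl | rfl) | ⟨m, hm, rfl⟩) | rfl)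
      · simpa using gx_pow_mem_layer (p := p) (k := k) 1
      · simpa using gy_pow_mem_layer (p := p) (k := k) 1
      · exact leftComm_mem_layer le_rfl (by rw [mu_one]; exact hm.1)
      · exact gz_mem_layer (by simp [mu_zero])
    · simp
    · exact Subgroup.subset_closure (by simp)
    · rw [mu_two]; omega
    · intro m hm hm'
      rw [mu_one] at hm
      exact Or.inl (Or.inr ⟨m, ⟨hm, by omega⟩, rfl⟩)
    · intro m _ hm hm'
      rw [mu_one] at hm'
      have : m = 1 := by omega
      subst this
      exact Or.inr rfl
  · split_ifs with h1
    · subst h1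
      exact_mod_cast hfactor 1 (p + 2) le_rfl (layerRank_one_of_eq_one hp3)
    · exact_mod_cast hfactor 1 (p + 3) hk (layerRank_one hp3 (by omega))
  · refine hgen i _ ?_
    simp only [Set.image_union, Set.image_singleton, Set.image_image, map_pow, hx, hc, hz]
    rw [nuFun_eq_mu hp3 hik, nuFun_eq_mu hp3 ((Nat.sub_le i 1).trans hik)]
    refine layer_eq_closure_sup hp2 (r := nuFun p k (i + 1)) (by omega) ?_ ?_ ?_ ?_ ?_ ?_
    · rintro u ((rfl | ⟨m, hm, rfl⟩) | ⟨m, hm, rfl⟩)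
      · exact gx_pow_mem_layer i
      · exact leftComm_mem_layer (by omega) hm.1
      · have h1 := hm.2.1
        exact gz_mem_layer (by omega)
    · exact Or.inl (Or.inl rfl)
    · rw [gy_pow_eq_one hi]; exact one_mem _
    · rw [nuFun_eq hp.two_le]
    · intro m hm hm'
      exact Or.inl (Or.inr ⟨m, ⟨hm, by omega⟩, rfl⟩)
    · intro m hm hm' hm''
      exact Or.inr ⟨m, ⟨hm, hm', hm''⟩, rfl⟩
  · split_ifs with h1
    · exact_mod_cast hfactor i _ hik (layerRank_of_lt hp3 hi (by omega))
    · have h1 : i = k := not_not.mp h1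
      subst h1
      have h2 := hfactor i _ le_rfl (layerRank_self hp3 hi)
      have h3 : mu p (i - 1) ≤ 1 + p ^ i := by
        have := two_mul_mu_lt hp3 i
        have := mu_mono p (Nat.sub_le i 1)
        omega
      rw [Nat.cast_sub h3, cast_mu hp.two_le] at h2
      convert h2 using 1
      push_cast; ring
  · rw [nuFun_eq_mu hp3 hjk, cast_mu hp.two_le]
  · exact nuFun_succ_self hp.two_le k
  · refine hinj ?_
    rw [hΦ, layer_succ_self_eq_closure hp2 hk, MonoidHom.map_closure, nuFun_eq_mu hp3 le_rfl]
    congr 1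
    rw [Set.image_image]
    exact Set.image_congr fun m _ => (hz m).symm
  · have h1 := isElemAbelianOfRank_frattiniSeries hp hbot (hcard (k + 1) le_rfl)
    have h2 : 2 * layerRank p k (k + 1) + 2 * mu p k + 1 = p ^ k := by
      rw [layerRank_succ_self hk]
      have := two_mul_mu_lt hp3 k
      have : p ^ k % 2 = 1 := Nat.odd_iff.mp (hp.odd_of_ne_two hp2).pow
      omega
    have h3 : (p : ℚ) - 1 ≠ 0 := sub_ne_zero.mpr (by exact_mod_cast hp.one_lt.ne')
    have h4 : 2 * (layerRank p k (k + 1) : ℚ) + 2 * mu p k + 1 = (p : ℚ) ^ k := by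
      exact_mod_cast h2
    rw [cast_mu hp.two_le] at h4
    convert h1 using 1
    rw [div_eq_iff (mul_ne_zero two_ne_zero h3)]
    field_simp at h4
    linear_combination -h4
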